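/- Let $\Bbbk$ be a field. Let $\mathcal{TL}_0(\Bbbk)$ be the strict $\Bbbk$-linear monoidal category with objects $[n]$, $n\in\mathbb N$, $[m]\otimes[n]=[m+n]$, generated by $\mathrm{cup}:[0]\to[2]$ and $\mathrm{cap}:[2]\to[0]$ subject to $\mathrm{cap}\circ\mathrm{cup}=\mathrm{id}_{[0]}$ and the zig-zag relations $(\mathrm{cap}\otimes\mathrm{id}_{[1]})\circ(\mathrm{id}_{[1]}\otimes\mathrm{cup})=0=(\mathrm{id}_{[1]}\otimes\mathrm{cap})\circ(\mathrm{cup}\otimes\mathrm{id}_{[1]})$. A Temperley–Lieb diagram (cup diagram, cap diagram) is a non-zero morphism obtained by tensoring and composing identities with cups and caps (with cups only, with caps only). For $I\subseteq\{1,\dots,n-1\}$ without two adjacent elements let $\mathrm{cap}_{I,n}$ be the cap diagram with domain $[n]$ and caps in positions $(i,i+1)$, $i\in I$, let $\mathrm{cup}_{I,n}$ be its mirror image, and let $j_n=\sum_I(-1)^{|I|}\,\mathrm{cup}_{I,n}\circ\mathrm{cap}_{I,n}\in\mathrm{End}([n])$ be the $n$-th Jones–Wenzl projector, the sum being over all such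 $I$. Let $n\in\mathbb N$ and let $T_n$ be the monoid, under composition, of the Temperley–Lieb diagrams $[n]\to[n]$ together with $0$. Then the following hold. 1. $T_n$ is a finite inverse monoid with trivial maximal subgroups. Let $x^{-1}$ be the inverse of $x$ in $T_n$, let $y\preccurlyeq x$ mean that $y=xe$ for some idempotent $e\in T_n$ (a partial order), let $\mu$ be the Möbius function of $\preccurlyeq$, and put $[x]=\sum_{y\preccurlyeq x}\mu(y,x)\,y\in\Bbbk T_n$ for $x\in T_n$. For a $\mathcal J$-cell $J$ of $T_n$ let $E(J)$ be the set of idempotents in $J$. There is an isomorphism of $\Bbbk$-algebras $\Psi:\Bbbk T_n\to\prod_J\mathrm{Mat}_{E(J)}(\Bbbk)$ such that, for all $x\in T_n$, $\Psi(x)=\sum_{y\preccurlyeq x}E_y$ and $[x]=\Psi^{-1}(E_x)$, where $E_x$ is the matrix unit in row $xx^{-1}$ and column $x^{-1}x$ of the block of the $\mathcal J$-cell of $x$. 2. Every Temperley–Lieb diagram $x:[n]\to[n]$ is uniquely of the form $x=u\circ v$ with $v:[n]\to[k]$ a cap diagram and $u:[k]\to[n]$ a cup diagram. Two diagrams are in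 the same $\mathcal J$-cell if and only if they have the same $k$. If $a,b:[k]\to[n]$ are cup diagrams with mirror images $\overline a,\overline b$, then $x=a\circ\overline b$ is a non-zero element of $T_n$ with $xx^{-1}=a\circ\overline a$ and $x^{-1}x=b\circ\overline b$; so the matrix units are indexed by pairs of cup diagrams with the same domain. 3. $\mathrm{End}_{\mathcal{TL}_0(\Bbbk)}([n])$ is the contracted monoid algebra of $T_n$: the quotient of $\Bbbk T_n$ by the ideal generated by the zero element $0\in T_n$ is isomorphic to $\mathrm{End}_{\mathcal{TL}_0(\Bbbk)}([n])$ as a $\Bbbk$-algebra, by an isomorphism sending the class of each $x\in T_n$ to $x$. 4. For a Temperley–Lieb diagram $x=u\circ v:[n]\to[n]$ as in 2, let $\widehat x=u\circ j_k\circ v$ be its max-summand morphism. The family of all $\widehat x$, for $x$ a Temperley–Lieb diagram $[n]\to[n]$, is a basis of $\mathrm{End}_{\mathcal{TL}_0(\Bbbk)}([n])$, and for every such $x$ $$\widehat x=[x],$$ where $[x]$ also denotes the image of $[x]\in\Bbbk T_n$ under the isomorphism in 3. So the max-summand basis coincides with the basis given by Möbius inversion for $T_n$. -/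

import Mathlib

open CategoryTheory

/-! ## The crystal Temperley–Lieb category `TL₀(k)` -/

namespace CrysTL

/-- Objects: the numbers of strands. -/
structure Strands where
  num : ℕ

/-- The basic cups `(i, cup, n - i) : n ⟶ n + 2` and the basic caps `(i, cap, n - i) : n + 2 ⟶ n`,
that is `id_i ⊗ cup ⊗ id_(n-i)` and `id_i ⊗ cap ⊗ id_(n-i)`. -/
inductive Basic : Strands → Strands → Type
  | cup (n i : ℕ) (h : i ≤ n) : Basic ⟨n⟩ ⟨n + 2⟩
  | cap (n i : ℕ) (h : i ≤ n) : Basic ⟨n + 2⟩ ⟨n⟩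

instance : Quiver Strands where
  Hom := Basic

/-- The free category on the basic cups and caps, and formal `k`-linear combinations in it. -/
abbrev Pre (k : Type*) [CommRing k] := Free k (Paths Strands)

section Pre

variable (k : Type*) [CommRing k]

/-- The object `n` of the free linear category. -/
noncomputable abbrev preObj (n : ℕ) : Pre k := (Free.embedding k (Paths Strands)).obj ((Paths.of Strands).obj ⟨n⟩)

/-- A basic cup, in the free linear category. -/
noncomputable def preCup (n i : ℕ) (h : i ≤ n) : preObj k n ⟶ preObj k (n + 2) :=
  (Free.embedding k (Paths Strands)).map ((Paths.of Strands).map (Basic.cup n i h))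

/-- A basic cap, in the free linear category. -/
noncomputable def preCap (n i : ℕ) (h : i ≤ n) : preObj k (n + 2) ⟶ preObj k n :=
  (Free.embedding k (Paths Strands)).map ((Paths.of Strands).map (Basic.cap n i h))

/-- The linear congruence defining `TL₀(k)`: it is generated by the circle evaluation
`cap ∘ cup = q² + 1 = 1`, the two zig-zag relations (a zig-zag is `q · id = 0`), both tensored
with identities on either side, and the interchange law of a strict monoidal category for two
basic cups or caps which act on disjoint groups of strands (the one at `i` lies to the left of the
one at `j`). -/
inductive Rel : ∀ ⦃X Y : Pre k⦄, (X ⟶ Y) → (X ⟶ Y) → Prop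
  | circle (n i : ℕ) (h : i ≤ n) : Rel (preCup k n i h ≫ preCap k n i h) (𝟙 _)
  | zigzag (n i : ℕ) (h : i + 1 ≤ n) :
      Rel (preCup k n i (by omega) ≫ preCap k n (i + 1) h) 0
  | zagzig (n i : ℕ) (h : i + 1 ≤ n) :
      Rel (preCup k n (i + 1) h ≫ preCap k n i (by omega)) 0
  | cup_cup (n i j : ℕ) (hij : i ≤ j) (hj : j ≤ n) :
      Rel (preCup k n i (by omega) ≫ preCup k (n + 2) (j + 2) (by omega))
        (preCup k n j hj ≫ preCup k (n + 2) i (by omega))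
  | cap_cap (n i j : ℕ) (hij : i ≤ j) (hj : j ≤ n) :
      Rel (preCap k (n + 2) i (by omega) ≫ preCap k n j hj)
        (preCap k (n + 2) (j + 2) (by omega) ≫ preCap k n i (by omega))
  | cap_cup (n i j : ℕ) (hij : i ≤ j) (hj : j ≤ n) :
      Rel (preCap k n i (by omega) ≫ preCup k n j hj)
        (preCup k (n + 2) (j + 2) (by omega) ≫ preCap k (n + 2) i (by omega))
  | cup_cap (n i j : ℕ) (hij : i ≤ j) (hj : j ≤ n) :
      Rel (preCup k (n + 2) i (by omega) ≫ preCap k (n + 2) (j + 2) (by omega))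
        (preCap k n j hj ≫ preCup k n i (by omega))
  | refl {X Y : Pre k} (f : X ⟶ Y) : Rel f f
  | symm {X Y : Pre k} {f g : X ⟶ Y} : Rel f g → Rel g f
  | trans {X Y : Pre k} {f g h : X ⟶ Y} : Rel f g → Rel g h → Rel f h
  | comp_left {X Y Z : Pre k} (f : X ⟶ Y) {g g' : Y ⟶ Z} : Rel g g' → Rel (f ≫ g) (f ≫ g')
  | comp_right {X Y Z : Pre k} {f f' : X ⟶ Y} (g : Y ⟶ Z) : Rel f f' → Rel (f ≫ g) (f' ≫ g)
  | add {X Y : Pre k} {f f' g g' : X ⟶ Y} : Rel f f' → Rel g g' → Rel (f + g) (f' + g')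
  | smul {X Y : Pre k} (a : k) {f f' : X ⟶ Y} : Rel f f' → Rel (a • f) (a • f')

/-- The relation as a relation on the morphisms of the free linear category. -/
def homRel : HomRel (Pre k) := fun _ _ f g => Rel k f g

instance : Congruence (homRel k) where
  comp_left f _ _ h := Rel.comp_left f h
  comp_right g h := Rel.comp_right g h
  equivalence := ⟨Rel.refl, Rel.symm, Rel.trans⟩

end Pre

/-- The category `TL₀(k)`. -/
abbrev TL (k : Type*) [CommRing k] := CategoryTheory.Quotient (homRel k)

section TL

variable (k : Type*) [CommRing k]

noncomputable instance : Preadditive (TL k) :=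
  Quotient.preadditive (homRel k) (fun _ _ _ _ _ _ h h' => Rel.add h h')

instance : (Quotient.functor (homRel k)).Additive :=
  Quotient.functor_additive (homRel k) (fun _ _ _ _ _ _ h h' => Rel.add h h')

noncomputable instance : Linear k (TL k) :=
  Quotient.linear k (homRel k) (fun a _ _ _ _ h => Rel.smul a h)

/-- The object `[n]` of `TL₀(k)`. -/
noncomputable abbrev obj (n : ℕ) : TL k := (Quotient.functor (homRel k)).obj (preObj k n)

/-- The basic cup `(i, cup, n - i)`. -/
noncomputable def cup (n i : ℕ) (h : i ≤ n) : obj k n ⟶ obj k (n + 2) :=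
  (Quotient.functor (homRel k)).map (preCup k n i h)

/-- The basic cap `(i, cap, n - i)`. -/
noncomputable def cap (n i : ℕ) (h : i ≤ n) : obj k (n + 2) ⟶ obj k n :=
  (Quotient.functor (homRel k)).map (preCap k n i h)

/-- Morphisms obtained from cups, caps and identities by tensoring and composition, i.e.
the finite composites of basic cups and basic caps (possibly zero). -/
inductive IsWord : ∀ {m n : ℕ}, (obj k m ⟶ obj k n) → Prop
  | id (n : ℕ) : IsWord (𝟙 (obj k n))
  | comp_cup {m n : ℕ} {f : obj k m ⟶ obj k n} (i : ℕ) (h : i ≤ n) :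
      IsWord f → IsWord (f ≫ cup k n i h)
  | comp_cap {m n : ℕ} {f : obj k m ⟶ obj k (n + 2)} (i : ℕ) (h : i ≤ n) :
      IsWord f → IsWord (f ≫ cap k n i h)

/-- Composites of basic cups. -/
inductive IsCupWord : ∀ {m n : ℕ}, (obj k m ⟶ obj k n) → Prop
  | id (n : ℕ) : IsCupWord (𝟙 (obj k n))
  | comp_cup {m n : ℕ} {f : obj k m ⟶ obj k n} (i : ℕ) (h : i ≤ n) :
      IsCupWord f → IsCupWord (f ≫ cup k n i h)

/-- Composites of basic caps. -/
inductive IsCapWord : ∀ {m n : ℕ}, (obj k m ⟶ obj k n) → Prop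
  | id (n : ℕ) : IsCapWord (𝟙 (obj k n))
  | comp_cap {m n : ℕ} {f : obj k m ⟶ obj k (n + 2)} (i : ℕ) (h : i ≤ n) :
      IsCapWord f → IsCapWord (f ≫ cap k n i h)

/-- `g` is the mirror image of the word `f`: the order of composition is reversed, and cups and
caps are exchanged. -/
inductive IsMirror : ∀ {m n : ℕ}, (obj k m ⟶ obj k n) → (obj k n ⟶ obj k m) → Prop
  | id (n : ℕ) : IsMirror (𝟙 (obj k n)) (𝟙 (obj k n))
  | comp_cup {m n : ℕ} {f : obj k m ⟶ obj k n} {g : obj k n ⟶ obj k m} (i : ℕ) (h : i ≤ n) :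
      IsMirror f g → IsMirror (f ≫ cup k n i h) (cap k n i h ≫ g)
  | comp_cap {m n : ℕ} {f : obj k m ⟶ obj k (n + 2)} {g : obj k (n + 2) ⟶ obj k m} (i : ℕ)
      (h : i ≤ n) : IsMirror f g → IsMirror (f ≫ cap k n i h) (cup k n i h ≫ g)

variable {k}

/-- Temperley–Lieb diagrams. -/
def IsDiagram {m n : ℕ} (f : obj k m ⟶ obj k n) : Prop := f ≠ 0 ∧ IsWord k f

/-- Cup diagrams. -/
def IsCupDiagram {m n : ℕ} (f : obj k m ⟶ obj k n) : Prop := f ≠ 0 ∧ IsCupWord k f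

/-- Cap diagrams. -/
def IsCapDiagram {m n : ℕ} (f : obj k m ⟶ obj k n) : Prop := f ≠ 0 ∧ IsCapWord k f

variable (k)

/-- For a list `I = [i₁, …, i_r]` of positions (decreasing, no two adjacent) this is
`cup_I ∘ cap_I`, where `cap_I = cap_{i_r} ∘ ⋯ ∘ cap_{i₁}` caps the strands `i` and `i + 1` for all
`i ∈ I` (strands numbered from `0`; later positions lie to the left of the earlier ones, so they are
not shifted), and `cup_I` is its mirror image. Ill-formed lists get the value `0`. -/
noncomputable def cupCap : (n : ℕ) → List ℕ → End (obj k n)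
  | _, [] => 𝟙 _
  | 0, _ :: _ => 0
  | 1, _ :: _ => 0
  | n + 2, i :: I => if h : i ≤ n then cap k n i h ≫ cupCap n I ≫ cup k n i h else 0

/-- The apt subsets of the set of positions `{0, …, n - 1}`: the last position does not belong to
`I`, and `I` contains no two adjacent positions. -/
def aptSubsets (n : ℕ) : Finset (Finset ℕ) :=
  (Finset.range n).powerset.filter fun I => ∀ i ∈ I, i + 1 ≠ n ∧ i + 1 ∉ I

/-- The `n`-th Jones–Wenzl projector `∑ (-1)^|I| cup_I ∘ cap_I`, over the apt subsets `I`. -/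
noncomputable def jonesWenzl (n : ℕ) : End (obj k n) :=
  ∑ I ∈ aptSubsets n, (-1 : k) ^ I.card • cupCap k n (I.sort (· ≥ ·))

variable {k}

/-- A factorization `f = u ∘ v` into a cap diagram `v` and a cup diagram `u`. -/
@[ext]
structure CupCapFactorization {m n : ℕ} (f : obj k m ⟶ obj k n) where
  /-- The number of through-strands. -/
  th : ℕ
  capPart : obj k m ⟶ obj k th
  cupPart : obj k th ⟶ obj k n
  isCap : IsCapDiagram capPart
  isCup : IsCupDiagram cupPart
  fac : capPart ≫ cupPart = f

open Classical in
/-- The max-summand morphism `u ∘ j_k ∘ v` of `f = u ∘ v`, and `0` for morphisms without a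
cup-cap factorization. -/
noncomputable def maxSummand {m n : ℕ} (f : obj k m ⟶ obj k n) : obj k m ⟶ obj k n :=
  if h : Nonempty (CupCapFactorization f) then
    h.some.capPart ≫ jonesWenzl k h.some.th ≫ h.some.cupPart
  else 0

theorem IsWord.comp {l m n : ℕ} {f : obj k l ⟶ obj k m} {g : obj k m ⟶ obj k n}
    (hf : IsWord k f) (hg : IsWord k g) : IsWord k (f ≫ g) := by
  induction hg with
  | id => simpa using hf
  | comp_cup i h _ ih => rw [← Category.assoc]; exact .comp_cup i h ih
  | comp_cap i h _ ih => rw [← Category.assoc]; exact .comp_cap i h ih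

variable (k)

/-- The monoid `T_n`: the Temperley–Lieb diagrams `[n] ⟶ [n]` and `0`, under composition. -/
def T (n : ℕ) : Submonoid (End (obj k n)) where
  carrier := {f | f = 0 ∨ IsDiagram (k := k) (m := n) (n := n) f}
  one_mem' := by
    by_cases h : (1 : End (obj k n)) = 0
    · exact Or.inl h
    · exact Or.inr ⟨h, IsWord.id n⟩
  mul_mem' := by
    rintro a b (rfl | ha) (rfl | hb)
    · exact Or.inl (zero_mul _)
    · exact Or.inl (zero_mul _)
    · exact Or.inl (mul_zero _)
    · by_cases h : a * b = 0
      · exact Or.inl h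
      · exact Or.inr ⟨h, IsWord.comp hb.2 ha.2⟩

noncomputable instance (n : ℕ) : MonoidWithZero (T k n) where
  zero := ⟨0, Or.inl rfl⟩
  zero_mul a := Subtype.ext (zero_mul (a : End (obj k n)))
  mul_zero a := Subtype.ext (mul_zero (a : End (obj k n)))

end TL

end CrysTL

/-! ## Finite inverse monoids -/

namespace InvMon

/-- Inverse monoids: every `s` has a unique `t` with `s = sts` and `t = tst`. -/
class IsInverse (M : Type*) [Monoid M] : Prop where
  existsUnique_inv : ∀ s : M, ∃! t : M, s = s * t * s ∧ t = t * s * t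

/-- The natural relation `s ≼ t`: `s = te` for some idempotent `e`. -/
def NatLE {M : Type*} [Monoid M] (s t : M) : Prop := ∃ e : M, IsIdempotentElem e ∧ s = t * e

section Inverse

variable {M : Type*} [Monoid M] [IsInverse M]

/-- The inverse of `s`. -/
noncomputable def inv (s : M) : M := (IsInverse.existsUnique_inv s).choose

theorem mul_inv_mul (s : M) : s * inv s * s = s :=
  (IsInverse.existsUnique_inv s).choose_spec.1.1.symm

theorem inv_mul_inv (s : M) : inv s * s * inv s = inv s :=
  (IsInverse.existsUnique_inv s).choose_spec.1.2.symm

theorem inv_unique {s t t' : M} (h₁ : s * t * s = s) (h₂ : t * s * t = t)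
    (h₁' : s * t' * s = s) (h₂' : t' * s * t' = t') : t = t' :=
  (IsInverse.existsUnique_inv s).unique ⟨h₁.symm, h₂.symm⟩ ⟨h₁'.symm, h₂'.symm⟩

theorem idem_mul_inv (s : M) : IsIdempotentElem (s * inv s) := by
  rw [IsIdempotentElem, ← mul_assoc, mul_inv_mul]

theorem idem_inv_mul (s : M) : IsIdempotentElem (inv s * s) := by
  rw [IsIdempotentElem, ← mul_assoc, inv_mul_inv]

theorem idem_mul {e f : M} (he : IsIdempotentElem e) (hf : IsIdempotentElem f) :
    IsIdempotentElem (e * f) := by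
  obtain ⟨x, hx⟩ : ∃ x, x = inv (e * f) := ⟨_, rfl⟩
  have h1 : e * f * x * (e * f) = e * f := hx ▸ mul_inv_mul _
  have h2 : x * (e * f) * x = x := hx ▸ inv_mul_inv _
  have hxx : f * x * e = x := by
    refine inv_unique (s := e * f) ?_ ?_ h1 h2
    · calc e * f * (f * x * e) * (e * f) = e * (f * f) * x * ((e * e) * f) := by
            simp only [mul_assoc]
        _ = e * f := by rw [hf.eq, he.eq, h1]
    · calc f * x * e * (e * f) * (f * x * e) = f * (x * ((e * e) * (f * f)) * x) * e := by
            simp only [mul_assoc]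
        _ = f * x * e := by rw [hf.eq, he.eq, h2]
  have hidem : x * x = x := by
    calc x * x = f * x * e * (f * x * e) := by rw [hxx]
      _ = f * (x * (e * f) * x) * e := by simp only [mul_assoc]
      _ = x := by rw [h2, hxx]
  have : e * f = x := by
    refine inv_unique (s := x) h2 h1 ?_ ?_ <;> rw [hidem, hidem]
  rw [this]
  exact hidem

theorem idem_comm {e f : M} (he : IsIdempotentElem e) (hf : IsIdempotentElem f) :
    e * f = f * e := by
  have hef := (idem_mul he hf).eq
  have hfe := (idem_mul hf he).eq
  refine inv_unique (s := e * f) ?_ ?_ ?_ ?_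
  · rw [hef, hef]
  · rw [hef, hef]
  · calc e * f * (f * e) * (e * f) = e * (f * f) * ((e * e) * f) := by simp only [mul_assoc]
      _ = e * f := by rw [hf.eq, he.eq, hef]
  · calc f * e * (e * f) * (f * e) = f * (e * e) * ((f * f) * e) := by simp only [mul_assoc]
      _ = f * e := by rw [hf.eq, he.eq, hfe]

variable (M) in
/-- The natural partial order of an inverse monoid. -/
abbrev natOrder : PartialOrder M where
  le := NatLE
  le_refl s := ⟨1, IsIdempotentElem.one, (mul_one s).symm⟩
  le_trans := by
    rintro s t u ⟨e, he, rfl⟩ ⟨f, hf, rfl⟩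
    exact ⟨f * e, idem_mul hf he, mul_assoc _ _ _⟩
  le_antisymm := by
    rintro s t ⟨e, he, hs⟩ ⟨f, hf, ht⟩
    have hse : s * e = s := by rw [hs, mul_assoc, he.eq]
    calc s = t * e := hs
      _ = s * f * e := by rw [← ht]
      _ = s * (f * e) := mul_assoc _ _ _
      _ = s * (e * f) := by rw [idem_comm hf he]
      _ = s * e * f := (mul_assoc _ _ _).symm
      _ = t := by rw [hse, ← ht]

open Classical in
/-- The Möbius function of the natural partial order. -/
noncomputable def mobius [Finite M] (s t : M) : ℤ :=
  letI := natOrder M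
  letI := Fintype.ofFinite M
  letI : LocallyFiniteOrder M := Fintype.toLocallyFiniteOrder
  IncidenceAlgebra.mu ℤ s t

end Inverse

section Finite

variable {M : Type*} [Monoid M] [Finite M]

/-- The elements `t ≼ s`. -/
noncomputable def lower (s : M) : Finset M := (Set.toFinite {t | NatLE t s}).toFinset

/-- The element `[s] = ∑_{t ≼ s} μ(t, s) t` of the monoid algebra. -/
noncomputable def bracket (k : Type*) [CommRing k] [IsInverse M] (s : M) : MonoidAlgebra k M :=
  ∑ t ∈ lower s, (mobius t s : k) • MonoidAlgebra.of k M t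

end Finite

section Green

variable (M : Type*) [Monoid M]

/-- Green's `𝓙`-equivalence: `x ∼ y` iff `MxM = MyM`. -/
def greenJ : Setoid M := Setoid.ker fun x : M => {z : M | ∃ a b, z = a * x * b}

/-- The set of `𝓙`-cells. -/
abbrev JCell : Type _ := _root_.Quotient (greenJ M)

variable {M}

/-- The `𝓙`-cell of an element. -/
abbrev cell (x : M) : JCell M := Quotient.mk (greenJ M) x

/-- The set `E(J)` of idempotents in a `𝓙`-cell `J`. -/
abbrev CellIdem (J : JCell M) : Type _ := {e : M // IsIdempotentElem e ∧ cell e = J}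

noncomputable instance (J : JCell M) : DecidableEq (CellIdem J) := Classical.decEq _

noncomputable instance : DecidableEq (JCell M) := Classical.decEq _

noncomputable instance [Finite M] (J : JCell M) : Fintype (CellIdem J) := Fintype.ofFinite _

variable (M) in
/-- All maximal subgroups (the groups of units of the monoids `eMe`, `e` idempotent) are trivial. -/
def TrivialMaximalSubgroups : Prop :=
  ∀ e : M, IsIdempotentElem e → ∀ x y : M, e * x * e = x → e * y * e = y →
    x * y = e → y * x = e → x = e

theorem cell_mul_inv [IsInverse M] (x : M) : cell (x * inv x) = cell x := by
  refine Quotient.sound (Set.ext fun z => ⟨?_, ?_⟩)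
  · rintro ⟨a, b, rfl⟩
    exact ⟨a, inv x * b, by simp only [mul_assoc]⟩
  · rintro ⟨a, b, rfl⟩
    refine ⟨a, x * b, ?_⟩
    calc a * x * b = a * (x * inv x * x) * b := by rw [mul_inv_mul]
      _ = a * (x * inv x) * (x * b) := by simp only [mul_assoc]

theorem cell_inv_mul [IsInverse M] (x : M) : cell (inv x * x) = cell x := by
  refine Quotient.sound (Set.ext fun z => ⟨?_, ?_⟩)
  · rintro ⟨a, b, rfl⟩
    exact ⟨a * inv x, b, by simp only [mul_assoc]⟩
  · rintro ⟨a, b, rfl⟩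
    refine ⟨a * x, b, ?_⟩
    calc a * x * b = a * (x * inv x * x) * b := by rw [mul_inv_mul]
      _ = a * x * (inv x * x) * b := by simp only [mul_assoc]

/-- The matrix unit of `x` in `∏_J Mat_{E(J)}(k)`: it lies in the block of the `𝓙`-cell of `x`, in
row `x x⁻¹` and column `x⁻¹ x`. -/
noncomputable def matrixUnit (k : Type*) [CommRing k] [IsInverse M] (x : M) :
    ∀ J : JCell M, Matrix (CellIdem J) (CellIdem J) k :=
  Pi.single (cell x)
    (Matrix.single ⟨x * inv x, idem_mul_inv x, cell_mul_inv x⟩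
      ⟨inv x * x, idem_inv_mul x, cell_inv_mul x⟩ 1)

end Green

section Contracted

variable (k M : Type*) [CommRing k] [MonoidWithZero M]

/-- The contracted monoid algebra: the quotient of `kM` by the ideal generated by the zero
element of `M`. -/
abbrev Contracted : Type _ :=
  RingQuot fun a b : MonoidAlgebra k M => a = MonoidAlgebra.of k M 0 ∧ b = 0

/-- The quotient map `kM → k₀M`. -/
noncomputable def toContracted : MonoidAlgebra k M →ₐ[k] Contracted k M :=
  RingQuot.mkAlgHom k _

end Contracted

end InvMon

/-! The category acts on functions of infinite sign sequences: a cup at `i` sends the delta function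
of `w` to that of `w` with `+-` inserted at `i`, and a cap is the transpose. Deleting undoes
inserting, which is the circle relation; zig-zags act by zero because two adjacent positions are
never both peaks `+-`. So every diagram acts on delta functions as a partial injection.

The relations move all caps before all cups, so a nonzero word is `mirror b ≫ a` with cup words `a`,
`b`. A cup word is determined by its codomain and the image of the constant sequence `+`
(`IsCupWord.eq_of_hits`), since any peak of that image belongs to an innermost cup, which can be
stripped off. If `a`, `b` have sequences `q`, `p`, the diagram sends `p` to `q`. Testing at such
pairs gives uniqueness of the factorization (`fac_unique`) and faithfulness of the action on words
(`IsWord.eq_of_act_eq`).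

Nonzero idempotents have the form `mirror a ≫ a` and act by multiplication with a function, so
idempotents commute and `T_n` is inverse. By `T.natLE_iff`, the entry of `y` at the pair `(p, q)` of
a diagram `x` is `1` if `x ≼ y` and `0` otherwise: the zeta function of the natural order. Moreover
`x` is determined by its two idempotents (`T.eq_of_inv`). For a finite inverse monoid with this
property, mapping `x` to the sum of the matrix units below it is multiplicative and invertible by
Möbius inversion.

By inclusion–exclusion over the set of peaks, the Jones–Wenzl projector keeps exactly the delta
functions of sequences without a peak in the first `n` entries. Hence a max-summand morphism has
entry `1` at its own pair and `0` at the pairs of all other diagrams. Comparing entries, `x` is the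
sum of the max-summand morphisms of all `y ≼ x` (`coe_eq_sum_maxSummand`), and Möbius inversion
identifies them with the brackets. -/

namespace CrysTL

/-! ### Linear extension of functors to the free linear category. -/

section FreeLift

universe w₁ w₂ w₃ w₄

variable {k : Type*} [CommRing k] {C : Type w₁} [Category.{w₂} C] {D : Type w₃} [Category.{w₄} D]
  [Preadditive D] [Linear k D]

theorem free_induction {X Y : C}
    {P : ((Free.embedding k C).obj X ⟶ (Free.embedding k C).obj Y) → Prop}
    (zero : P 0) (add : ∀ f g, P f → P g → P (f + g))
    (smul : ∀ (a : k) (f : X ⟶ Y), P (a • (Free.embedding k C).map f))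
    (f : (Free.embedding k C).obj X ⟶ (Free.embedding k C).obj Y) : P f := by
  have single (g : X ⟶ Y) (a : k) : P (Finsupp.single g a : (X ⟶ Y) →₀ k) := by
    have h : (Finsupp.single g a : (X ⟶ Y) →₀ k) = a • Finsupp.single g 1 :=
      (Finsupp.smul_single_one g a).symm
    exact (congrArg P h).mpr (smul a g)
  exact Finsupp.induction_linear (M := k) (motive := P) f zero (fun f g => add f g) single

/-- The linear extension of a functor to morphisms of the free linear category. -/
noncomputable def freeMap (F : C ⥤ D) (X Y : C) :
    ((Free.embedding k C).obj X ⟶ (Free.embedding k C).obj Y) →ₗ[k] (F.obj X ⟶ F.obj Y) :=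
  Finsupp.lsum (M := k) k fun f : X ⟶ Y => LinearMap.toSpanSingleton k _ (F.map f)

theorem freeMap_embedding (F : C ⥤ D) {X Y : C} (f : X ⟶ Y) :
    freeMap (k := k) F X Y ((Free.embedding k C).map f) = F.map f := by
  refine (Finsupp.lsum_single (R := k) (M := k) k
    (fun f : X ⟶ Y => LinearMap.toSpanSingleton k _ (F.map f)) f (1 : k)).trans ?_
  simp

theorem freeMap_comp (F : C ⥤ D) {X Y Z : C}
    (f : (Free.embedding k C).obj X ⟶ (Free.embedding k C).obj Y)
    (g : (Free.embedding k C).obj Y ⟶ (Free.embedding k C).obj Z) :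
    freeMap (k := k) F X Z (f ≫ g) = freeMap (k := k) F X Y f ≫ freeMap (k := k) F Y Z g := by
  induction f using free_induction with
  | zero => rw [Limits.zero_comp, map_zero, map_zero, Limits.zero_comp]
  | add f₁ f₂ h₁ h₂ =>
    rw [Preadditive.add_comp, map_add, map_add, h₁, h₂, Preadditive.add_comp]
  | smul a f =>
    induction g using free_induction with
    | zero => rw [Limits.comp_zero, map_zero, map_zero, Limits.comp_zero]
    | add f₁ f₂ h₁ h₂ =>
      rw [Preadditive.comp_add, map_add, map_add, h₁, h₂, Preadditive.comp_add]
    | smul b g =>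
      rw [Linear.smul_comp, Linear.comp_smul, ← Functor.map_comp, map_smul, map_smul,
        map_smul, map_smul, freeMap_embedding, freeMap_embedding, freeMap_embedding,
        Linear.smul_comp, Linear.comp_smul, Functor.map_comp]

variable (k) in
/-- The extension of a functor to a functor on the free linear category. -/
noncomputable def freeLift (F : C ⥤ D) : Free k C ⥤ D where
  obj X := F.obj X
  map {X Y} f := freeMap (k := k) F X Y f
  map_id X := by
    refine Eq.trans ?_ (F.map_id X)
    exact freeMap_embedding F (@CategoryStruct.id C _ X)
  map_comp f g := freeMap_comp F f g

end FreeLift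

/-- Mirroring is contravariant, so it is obtained as a linear functor to the opposite category. -/
instance opLinear {k C : Type*} [CommRing k] [Category C] [Preadditive C] [Linear k C] :
    Linear k Cᵒᵖ where
  homModule X Y := (opEquiv X Y).module k
  smul_comp _ _ _ a f g := congrArg Quiver.Hom.op (Linear.comp_smul _ _ _ g.unop a f.unop)
  comp_smul _ _ _ f a g := congrArg Quiver.Hom.op (Linear.smul_comp _ _ _ a g.unop f.unop)

/-! ### The universal property of `TL₀(k)`. -/

section Lift

universe w₃ w₄
variable (k : Type*) [CommRing k] {D : Type w₃} [Category.{w₄} D] [Preadditive D] [Linear k D]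

/-- Objects and generating morphisms in a linear category which satisfy the defining relations
of `TL₀(k)`. -/
structure Model (D : Type w₃) [Category.{w₄} D] [Preadditive D] where
  obj : ℕ → D
  cup (n i : ℕ) (h : i ≤ n) : obj n ⟶ obj (n + 2)
  cap (n i : ℕ) (h : i ≤ n) : obj (n + 2) ⟶ obj n
  circle (n i : ℕ) (h : i ≤ n) : cup n i h ≫ cap n i h = 𝟙 _
  zigzag (n i : ℕ) (h : i + 1 ≤ n) : cup n i (by omega) ≫ cap n (i + 1) h = 0
  zagzig (n i : ℕ) (h : i + 1 ≤ n) : cup n (i + 1) h ≫ cap n i (by omega) = 0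
  cup_cup (n i j : ℕ) (hij : i ≤ j) (hj : j ≤ n) :
    cup n i (by omega) ≫ cup (n + 2) (j + 2) (by omega) = cup n j hj ≫ cup (n + 2) i (by omega)
  cap_cap (n i j : ℕ) (hij : i ≤ j) (hj : j ≤ n) :
    cap (n + 2) i (by omega) ≫ cap n j hj = cap (n + 2) (j + 2) (by omega) ≫ cap n i (by omega)
  cap_cup (n i j : ℕ) (hij : i ≤ j) (hj : j ≤ n) :
    cap n i (by omega) ≫ cup n j hj = cup (n + 2) (j + 2) (by omega) ≫ cap (n + 2) i (by omega)
  cup_cap (n i j : ℕ) (hij : i ≤ j) (hj : j ≤ n) :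
    cup (n + 2) i (by omega) ≫ cap (n + 2) (j + 2) (by omega) = cap n j hj ≫ cup n i (by omega)

variable (M : Model D)

/-- The generators of a model as a prefunctor. -/
def Model.prefunctor : Strands ⥤q D where
  obj X := M.obj X.num
  map
    | .cup n i h => M.cup n i h
    | .cap n i h => M.cap n i h

/-- The functor from the free linear category given by a model. -/
noncomputable def Model.preFunctor : Pre k ⥤ D := freeLift k (Paths.lift M.prefunctor)

theorem Model.preFunctor_cup (n i : ℕ) (h : i ≤ n) :
    (M.preFunctor k).map (preCup k n i h) = M.cup n i h :=
  (freeMap_embedding (Paths.lift M.prefunctor) _).trans (Paths.lift_toPath M.prefunctor _)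

theorem Model.preFunctor_cap (n i : ℕ) (h : i ≤ n) :
    (M.preFunctor k).map (preCap k n i h) = M.cap n i h :=
  (freeMap_embedding (Paths.lift M.prefunctor) _).trans (Paths.lift_toPath M.prefunctor _)

theorem Model.preFunctor_add {X Y : Pre k} (f g : X ⟶ Y) :
    (M.preFunctor k).map (f + g) = (M.preFunctor k).map f + (M.preFunctor k).map g :=
  map_add (freeMap (k := k) (Paths.lift M.prefunctor) X Y) f g

theorem Model.preFunctor_smul {X Y : Pre k} (a : k) (f : X ⟶ Y) :
    (M.preFunctor k).map (a • f) = a • (M.preFunctor k).map f :=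
  map_smul (freeMap (k := k) (Paths.lift M.prefunctor) X Y) a f

theorem Model.preFunctor_zero {X Y : Pre k} :
    (M.preFunctor k).map (0 : X ⟶ Y) = 0 :=
  map_zero (freeMap (k := k) (Paths.lift M.prefunctor) X Y)

theorem Model.preFunctor_rel {X Y : Pre k} {f g : X ⟶ Y} (h : Rel k f g) :
    (M.preFunctor k).map f = (M.preFunctor k).map g := by
  induction h with
  | circle n i h =>
    rw [Functor.map_comp, M.preFunctor_cup k, M.preFunctor_cap k, CategoryTheory.Functor.map_id]
    exact M.circle n i h
  | zigzag n i h =>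
    rw [Functor.map_comp, M.preFunctor_cup k, M.preFunctor_cap k, M.preFunctor_zero k]
    exact M.zigzag n i h
  | zagzig n i h =>
    rw [Functor.map_comp, M.preFunctor_cup k, M.preFunctor_cap k, M.preFunctor_zero k]
    exact M.zagzig n i h
  | cup_cup n i j hij hj =>
    rw [Functor.map_comp, Functor.map_comp]
    iterate 4 rw [M.preFunctor_cup k]
    exact M.cup_cup n i j hij hj
  | cap_cap n i j hij hj =>
    rw [Functor.map_comp, Functor.map_comp]
    iterate 4 rw [M.preFunctor_cap k]
    exact M.cap_cap n i j hij hj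
  | cap_cup n i j hij hj =>
    rw [Functor.map_comp, Functor.map_comp]
    iterate 2 rw [M.preFunctor_cap k, M.preFunctor_cup k]
    exact M.cap_cup n i j hij hj
  | cup_cap n i j hij hj =>
    rw [Functor.map_comp, Functor.map_comp]
    iterate 2 rw [M.preFunctor_cap k, M.preFunctor_cup k]
    exact M.cup_cap n i j hij hj
  | refl => rfl
  | symm _ ih => exact ih.symm
  | trans _ _ ih₁ ih₂ => exact ih₁.trans ih₂
  | comp_left f _ ih => rw [Functor.map_comp, Functor.map_comp, ih]
  | comp_right f _ ih => rw [Functor.map_comp, Functor.map_comp, ih]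
  | add _ _ ih₁ ih₂ => rw [M.preFunctor_add k, M.preFunctor_add k, ih₁, ih₂]
  | smul a _ ih => rw [M.preFunctor_smul k, M.preFunctor_smul k, ih]

/-- The functor from `TL₀(k)` given by a model. -/
noncomputable def Model.functor : TL k ⥤ D :=
  CategoryTheory.Quotient.lift (homRel k) (M.preFunctor k) fun _ _ _ _ h => M.preFunctor_rel k h

/-- The linear map on morphisms of `TL₀(k)` given by a model. -/
noncomputable def Model.map (m n : ℕ) : (CrysTL.obj k m ⟶ CrysTL.obj k n) →ₗ[k] (M.obj m ⟶ M.obj n) where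
  toFun f := (M.functor k).map f
  map_add' f g := by
    obtain ⟨f, rfl⟩ := (CategoryTheory.Quotient.functor (homRel k)).map_surjective f
    obtain ⟨g, rfl⟩ := (CategoryTheory.Quotient.functor (homRel k)).map_surjective g
    exact M.preFunctor_add k f g
  map_smul' a f := by
    obtain ⟨f, rfl⟩ := (CategoryTheory.Quotient.functor (homRel k)).map_surjective f
    exact M.preFunctor_smul k a f

theorem Model.map_id (n : ℕ) : M.map k n n (𝟙 _) = 𝟙 _ := (M.functor k).map_id _

theorem Model.map_comp {l m n : ℕ} (f : CrysTL.obj k l ⟶ CrysTL.obj k m) (g : CrysTL.obj k m ⟶ CrysTL.obj k n) :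
    M.map k l n (f ≫ g) = M.map k l m f ≫ M.map k m n g := (M.functor k).map_comp f g

theorem Model.map_cup (n i : ℕ) (h : i ≤ n) : M.map k _ _ (CrysTL.cup k n i h) = M.cup n i h :=
  M.preFunctor_cup k n i h

theorem Model.map_cap (n i : ℕ) (h : i ≤ n) : M.map k _ _ (CrysTL.cap k n i h) = M.cap n i h :=
  M.preFunctor_cap k n i h

end Lift

/-! ### The relations of `TL₀(k)` and their mirror symmetry. -/

section Relations

variable (k : Type*) [CommRing k]

/-- `TL₀(k)` as a model of its own relations. -/
noncomputable def selfModel : Model (TL k) where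
  obj := obj k
  cup := cup k
  cap := cap k
  circle n i h := CategoryTheory.Quotient.sound (homRel k) (Rel.circle n i h)
  zigzag n i h := CategoryTheory.Quotient.sound (homRel k) (Rel.zigzag n i h)
  zagzig n i h := CategoryTheory.Quotient.sound (homRel k) (Rel.zagzig n i h)
  cup_cup n i j hij hj := CategoryTheory.Quotient.sound (homRel k) (Rel.cup_cup n i j hij hj)
  cap_cap n i j hij hj := CategoryTheory.Quotient.sound (homRel k) (Rel.cap_cap n i j hij hj)
  cap_cup n i j hij hj := CategoryTheory.Quotient.sound (homRel k) (Rel.cap_cup n i j hij hj)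
  cup_cap n i j hij hj := CategoryTheory.Quotient.sound (homRel k) (Rel.cup_cap n i j hij hj)

/-- The mirror images of the generators. -/
noncomputable def mirrorModel : Model (TL k)ᵒᵖ where
  obj n := .op (obj k n)
  cup n i h := (cap k n i h).op
  cap n i h := (cup k n i h).op
  circle n i h := congrArg Quiver.Hom.op ((selfModel k).circle n i h)
  -- Reversing the composition exchanges the two zig-zag relations.
  zigzag n i h := congrArg Quiver.Hom.op ((selfModel k).zagzig n i h)
  zagzig n i h := congrArg Quiver.Hom.op ((selfModel k).zigzag n i h)
  cup_cup n i j hij hj := congrArg Quiver.Hom.op ((selfModel k).cap_cap n i j hij hj).symm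
  cap_cap n i j hij hj := congrArg Quiver.Hom.op ((selfModel k).cup_cup n i j hij hj).symm
  cap_cup n i j hij hj := congrArg Quiver.Hom.op ((selfModel k).cup_cap n i j hij hj).symm
  cup_cap n i j hij hj := congrArg Quiver.Hom.op ((selfModel k).cap_cup n i j hij hj).symm

end Relations

end CrysTL

namespace CrysTL

/-! ### Sign sequences -/

/-- Infinite sign sequences. -/
abbrev Signs := ℕ → Bool

noncomputable instance : DecidableEq Signs := Classical.decEq _

namespace Signs

/-- The constant sequence `+`. -/
def top : Signs := fun _ => true

/-- Insert `+-` at position `i`. -/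
def ins (i : ℕ) (w : Signs) : Signs := fun j =>
  if j < i then w j else if j = i then true else if j = i + 1 then false else w (j - 2)

/-- Delete the entries at the positions `i` and `i + 1`. -/
def del (i : ℕ) (w : Signs) : Signs := fun j => if j < i then w j else w (j + 2)

/-- The sequence has the entries `+-` at the positions `i` and `i + 1`. -/
def Peak (w : Signs) (i : ℕ) : Prop := w i = true ∧ w (i + 1) = false

instance (w : Signs) (i : ℕ) : Decidable (w.Peak i) := inferInstanceAs (Decidable (_ ∧ _))

theorem del_ins (i : ℕ) (w : Signs) : del i (ins i w) = w := by
  funext j; simp only [del, ins]; grind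

theorem ins_injective (i : ℕ) : Function.Injective (ins i) :=
  Function.LeftInverse.injective (del_ins i)

theorem peak_ins (i : ℕ) (w : Signs) : (ins i w).Peak i := by simp [Peak, ins]

theorem ins_del {i : ℕ} {w : Signs} (h : w.Peak i) : ins i (del i w) = w := by
  obtain ⟨h₁, h₂⟩ := h
  funext j
  simp only [del, ins]
  rcases lt_trichotomy j i with h | rfl | h
  · simp [h]
  · simp [h₁]
  · obtain ⟨l, rfl⟩ : ∃ l, j = i + 1 + l := ⟨j - (i + 1), by omega⟩
    rcases l with _ | l
    · simp [h₂]
    · have : i + 1 + (l + 1) - 2 + 2 = i + 1 + (l + 1) := by omega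
      rw [this]; grind

theorem peak_ins_of_add_two_le {i j : ℕ} (h : i + 2 ≤ j) (w : Signs) :
    (ins i w).Peak j ↔ w.Peak (j - 2) := by
  obtain ⟨l, rfl⟩ : ∃ l, j = i + 2 + l := ⟨j - (i + 2), by omega⟩
  have e₁ : i + 2 + l - 2 = i + l := by omega
  have e₂ : i + 2 + l + 1 - 2 = i + l + 1 := by omega
  simp only [Peak, ins, e₁, e₂]
  grind

theorem peak_ins_of_lt {i j : ℕ} (h : j + 1 < i) (w : Signs) : (ins i w).Peak j ↔ w.Peak j := by
  simp only [Peak, ins]; grind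

/-- A peak next to the inserted pair would need the opposite sign at the shared position. This is
why zig-zags act by zero. -/
theorem not_peak_ins_succ (i : ℕ) (w : Signs) : ¬ (ins i w).Peak (i + 1) := by
  simp [Peak, ins]

theorem not_peak_ins_pred (i : ℕ) (w : Signs) : ¬ (ins (i + 1) w).Peak i := by
  simp [Peak, ins]

theorem peak_del_of_le {i j : ℕ} (h : i ≤ j) (w : Signs) :
    (del i w).Peak j ↔ w.Peak (j + 2) := by
  simp only [Peak, del]; grind

theorem peak_del_of_lt {i j : ℕ} (h : j + 1 < i) (w : Signs) : (del i w).Peak j ↔ w.Peak j := by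
  simp only [Peak, del]; grind

theorem not_peak_top (i : ℕ) : ¬ top.Peak i := by simp [Peak, top]

theorem ins_ne_top (i : ℕ) (w : Signs) : ins i w ≠ top := fun h =>
  not_peak_top i (h ▸ peak_ins i w)

/-- This and the next three rules are the interchange laws of `TL₀(k)`, read on sign sequences. -/
theorem del_del {i j : ℕ} (h : i ≤ j) (w : Signs) : del i (del (j + 2) w) = del j (del i w) := by
  funext l; simp only [del]; grind

theorem ins_ins {i j : ℕ} (h : i ≤ j) (w : Signs) : ins i (ins j w) = ins (j + 2) (ins i w) := by
  funext l; simp only [ins]; grind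

theorem ins_del_comm {i j : ℕ} (h : i ≤ j) (w : Signs) :
    ins i (del j w) = del (j + 2) (ins i w) := by
  funext l
  simp only [ins, del]
  rcases lt_or_ge l (i + 2) with hl | hl
  · grind
  · obtain ⟨l, rfl⟩ : ∃ m, l = m + 2 := ⟨l - 2, by omega⟩
    have : l + 2 + 2 - 2 = l + 2 := by omega
    grind

theorem del_ins_comm {i j : ℕ} (h : i ≤ j) (w : Signs) :
    del i (ins (j + 2) w) = ins j (del i w) := by
  funext l
  simp only [ins, del]
  rcases lt_or_ge l (j + 2) with hl | hl
  · grind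
  · obtain ⟨l, rfl⟩ : ∃ m, l = m + 2 := ⟨l - 2, by omega⟩
    grind

end Signs

open Signs

/-! ### The action of `TL₀(k)` on functions of sign sequences -/

section Action

variable (k : Type*) [CommRing k]

/-- The action of a cup: it sends the delta function of `w` to that of `ins i w`. -/
def cupEnd (i : ℕ) : Module.End k (Signs → k) where
  toFun F w := if w.Peak i then F (del i w) else 0
  map_add' F G := by ext w; dsimp; split_ifs <;> simp
  map_smul' a F := by ext w; dsimp; split_ifs <;> simp

/-- The action of a cap: the transpose of the action of a cup. -/
def capEnd (i : ℕ) : Module.End k (Signs → k) where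
  toFun F w := F (ins i w)
  map_add' _ _ := rfl
  map_smul' _ _ := rfl

theorem cupEnd_apply (i : ℕ) (F : Signs → k) (w : Signs) :
    cupEnd k i F w = if w.Peak i then F (del i w) else 0 := rfl

theorem capEnd_apply (i : ℕ) (F : Signs → k) (w : Signs) : capEnd k i F w = F (ins i w) := rfl

/-- The action of `TL₀(k)` on functions of sign sequences, as a model. -/
noncomputable def signModel : Model (ModuleCat k) where
  -- The module does not depend on the number of strands; entries beyond them serve as padding.
  obj _ := ModuleCat.of k (Signs → k)
  cup _ i _ := ModuleCat.ofHom (cupEnd k i)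
  cap _ i _ := ModuleCat.ofHom (capEnd k i)
  circle n i h := by
    ext F w
    change (if (ins i w).Peak i then F (del i (ins i w)) else 0) = F w
    rw [if_pos (peak_ins i w), del_ins]
  zigzag n i h := by
    ext F w
    exact if_neg (not_peak_ins_pred i w)
  zagzig n i h := by
    ext F w
    exact if_neg (not_peak_ins_succ i w)
  cup_cup n i j hij hj := by
    ext F w
    change (if w.Peak (j + 2) then if (del (j + 2) w).Peak i then F _ else 0 else 0) =
      (if w.Peak i then if (del i w).Peak j then F _ else 0 else 0)
    simp only [peak_del_of_lt (show i + 1 < j + 2 by omega), peak_del_of_le hij, del_del hij]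
    split_ifs <;> rfl
  cap_cap n i j hij hj := by
    ext F w
    exact congrArg F (ins_ins hij w)
  cap_cup n i j hij hj := by
    ext F w
    change (if w.Peak j then F _ else 0) = (if (ins i w).Peak (j + 2) then F _ else 0)
    simp only [peak_ins_of_add_two_le (show i + 2 ≤ j + 2 by omega), ins_del_comm hij,
      Nat.add_sub_cancel]
  cup_cap n i j hij hj := by
    ext F w
    change (if (ins (j + 2) w).Peak i then F _ else 0) = (if w.Peak i then F _ else 0)
    simp only [peak_ins_of_lt (show i + 1 < j + 2 by omega), del_ins_comm hij]

variable {k}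

/-- The action of morphisms of `TL₀(k)` on functions of sign sequences. -/
noncomputable def act {m n : ℕ} : (obj k m ⟶ obj k n) →ₗ[k] Module.End k (Signs → k) :=
  (ModuleCat.homLinearEquiv (S := k)).toLinearMap ∘ₗ (signModel k).map k m n

theorem act_id (n : ℕ) : act (𝟙 (obj k n)) = 1 :=
  congrArg ModuleCat.Hom.hom ((signModel k).map_id k n)

theorem act_comp {l m n : ℕ} (f : obj k l ⟶ obj k m) (g : obj k m ⟶ obj k n) :
    act (f ≫ g) = act g * act f :=
  congrArg ModuleCat.Hom.hom ((signModel k).map_comp k f g)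

theorem act_cup (n i : ℕ) (h : i ≤ n) : act (cup k n i h) = cupEnd k i :=
  congrArg ModuleCat.Hom.hom ((signModel k).map_cup k n i h)

theorem act_cap (n i : ℕ) (h : i ≤ n) : act (cap k n i h) = capEnd k i :=
  congrArg ModuleCat.Hom.hom ((signModel k).map_cap k n i h)

/-- The mirror image of a morphism. -/
noncomputable def mirror {m n : ℕ} : (obj k m ⟶ obj k n) →ₗ[k] (obj k n ⟶ obj k m) where
  toFun f := ((mirrorModel k).map k m n f).unop
  map_add' f g := congrArg Quiver.Hom.unop (map_add ((mirrorModel k).map k m n) f g)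
  map_smul' a f := congrArg Quiver.Hom.unop (map_smul ((mirrorModel k).map k m n) a f)

@[simp] theorem mirror_id (n : ℕ) : mirror (𝟙 (obj k n)) = 𝟙 _ :=
  congrArg Quiver.Hom.unop ((mirrorModel k).map_id k n)

@[simp] theorem mirror_comp {l m n : ℕ} (f : obj k l ⟶ obj k m) (g : obj k m ⟶ obj k n) :
    mirror (f ≫ g) = mirror g ≫ mirror f :=
  congrArg Quiver.Hom.unop ((mirrorModel k).map_comp k f g)

@[simp] theorem mirror_cup (n i : ℕ) (h : i ≤ n) : mirror (cup k n i h) = cap k n i h :=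
  congrArg Quiver.Hom.unop ((mirrorModel k).map_cup k n i h)

@[simp] theorem mirror_cap (n i : ℕ) (h : i ≤ n) : mirror (cap k n i h) = cup k n i h :=
  congrArg Quiver.Hom.unop ((mirrorModel k).map_cap k n i h)

/-- As `mirror` is defined on all morphisms by the universal property, the mirror image does not
depend on how a word is written. -/
theorem IsMirror.eq_mirror {m n : ℕ} {f : obj k m ⟶ obj k n} {g : obj k n ⟶ obj k m}
    (h : IsMirror k f g) : g = mirror f := by
  induction h with
  | id => simp
  | comp_cup i h _ ih => simp [ih]
  | comp_cap i h _ ih => simp [ih]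

/-- On delta functions the generators act by partial injections: a cup inserts `+-`, a cap removes
it or gives zero. -/
theorem act_cup_single (n i : ℕ) (h : i ≤ n) (w : Signs) :
    act (cup k n i h) (Pi.single w 1) = Pi.single (ins i w) 1 := by
  funext x
  rw [act_cup, cupEnd_apply]
  by_cases hx : x.Peak i
  · rw [if_pos hx]
    obtain ⟨y, rfl⟩ : ∃ y, x = ins i y := ⟨_, (ins_del hx).symm⟩
    rw [del_ins]
    simp only [Pi.single_apply, (ins_injective i).eq_iff]
  · rw [if_neg hx, Pi.single_eq_of_ne]
    rintro rfl
    exact hx (peak_ins i w)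

theorem act_cap_single_ins (n i : ℕ) (h : i ≤ n) (w : Signs) :
    act (cap k n i h) (Pi.single (ins i w) 1) = Pi.single w 1 := by
  funext x
  rw [act_cap, capEnd_apply]
  simp only [Pi.single_apply, (ins_injective i).eq_iff]

theorem act_cap_single_of_not_peak (n i : ℕ) (h : i ≤ n) {w : Signs} (hw : ¬ w.Peak i) :
    act (cap k n i h) (Pi.single w 1) = 0 := by
  funext x
  rw [act_cap, capEnd_apply, Pi.zero_apply, Pi.single_eq_of_ne]
  rintro rfl
  exact hw (peak_ins i x)

end Action

end CrysTL

namespace CrysTL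

open Signs

section Words

variable {k : Type*} [CommRing k]

/-! ### Words in cups and caps -/

theorem cup_comp_cap_self (n i : ℕ) (h : i ≤ n) : cup k n i h ≫ cap k n i h = 𝟙 _ :=
  (selfModel k).circle n i h

theorem cup_comp_cap_succ (n i : ℕ) (h : i ≤ n) (h' : i + 1 ≤ n) :
    cup k n i h ≫ cap k n (i + 1) h' = 0 :=
  (selfModel k).zigzag n i h'

theorem cup_succ_comp_cap (n i : ℕ) (h : i ≤ n) (h' : i + 1 ≤ n) :
    cup k n (i + 1) h' ≫ cap k n i h = 0 :=
  (selfModel k).zagzig n i h'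

theorem cup_comp_cup (n i j : ℕ) (hij : i ≤ j) (hj : j ≤ n) :
    cup k n i (by omega) ≫ cup k (n + 2) (j + 2) (by omega) =
      cup k n j hj ≫ cup k (n + 2) i (by omega) :=
  (selfModel k).cup_cup n i j hij hj

theorem cap_comp_cup (n i j : ℕ) (hij : i ≤ j) (hj : j ≤ n) :
    cap k n i (by omega) ≫ cup k n j hj =
      cup k (n + 2) (j + 2) (by omega) ≫ cap k (n + 2) i (by omega) :=
  (selfModel k).cap_cup n i j hij hj

theorem cup_comp_cap (n i j : ℕ) (hij : i ≤ j) (hj : j ≤ n) :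
    cup k (n + 2) i (by omega) ≫ cap k (n + 2) (j + 2) (by omega) =
      cap k n j hj ≫ cup k n i (by omega) :=
  (selfModel k).cup_cap n i j hij hj

theorem isWord_cup (n i : ℕ) (h : i ≤ n) : IsWord k (cup k n i h) := by
  simpa using (IsWord.id (k := k) n).comp_cup i h

theorem isWord_cap (n i : ℕ) (h : i ≤ n) : IsWord k (cap k n i h) := by
  simpa using (IsWord.id (k := k) (n + 2)).comp_cap i h

theorem isCupWord_cup (n i : ℕ) (h : i ≤ n) : IsCupWord k (cup k n i h) := by
  simpa using (IsCupWord.id (k := k) n).comp_cup i h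

theorem isCapWord_cap (n i : ℕ) (h : i ≤ n) : IsCapWord k (cap k n i h) := by
  simpa using (IsCapWord.id (k := k) (n + 2)).comp_cap i h

theorem IsCupWord.comp {l m n : ℕ} {f : obj k l ⟶ obj k m} {g : obj k m ⟶ obj k n}
    (hf : IsCupWord k f) (hg : IsCupWord k g) : IsCupWord k (f ≫ g) := by
  induction hg with
  | id => simpa using hf
  | comp_cup i h _ ih => rw [← Category.assoc]; exact .comp_cup i h ih

theorem IsCapWord.comp {l m n : ℕ} {f : obj k l ⟶ obj k m} {g : obj k m ⟶ obj k n}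
    (hf : IsCapWord k f) (hg : IsCapWord k g) : IsCapWord k (f ≫ g) := by
  induction hg with
  | id => simpa using hf
  | comp_cap i h _ ih => rw [← Category.assoc]; exact .comp_cap i h ih

theorem IsCupWord.isWord {m n : ℕ} {f : obj k m ⟶ obj k n} (h : IsCupWord k f) :
    IsWord k f := by
  induction h with
  | id => exact .id _
  | comp_cup i h _ ih => exact ih.comp_cup i h

theorem IsCapWord.isWord {m n : ℕ} {f : obj k m ⟶ obj k n} (h : IsCapWord k f) :
    IsWord k f := by
  induction h with
  | id => exact .id _
  | comp_cap i h _ ih => exact ih.comp_cap i h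

theorem IsWord.mirrored {m n : ℕ} {f : obj k m ⟶ obj k n} (h : IsWord k f) :
    IsWord k (mirror f) := by
  induction h with
  | id => simpa using .id _
  | comp_cup i h _ ih => simpa using (isWord_cap _ i h).comp ih
  | comp_cap i h _ ih => simpa using (isWord_cup _ i h).comp ih

theorem IsCupWord.mirrored {m n : ℕ} {f : obj k m ⟶ obj k n} (h : IsCupWord k f) :
    IsCapWord k (mirror f) := by
  induction h with
  | id => simpa using .id _
  | comp_cup i h _ ih => simpa using (isCapWord_cap _ i h).comp ih

theorem IsCapWord.mirrored {m n : ℕ} {f : obj k m ⟶ obj k n} (h : IsCapWord k f) :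
    IsCupWord k (mirror f) := by
  induction h with
  | id => simpa using .id _
  | comp_cap i h _ ih => simpa using (isCupWord_cup _ i h).comp ih

theorem IsWord.mirror_mirror {m n : ℕ} {f : obj k m ⟶ obj k n} (h : IsWord k f) :
    mirror (mirror f) = f := by
  induction h with
  | id => simp
  | comp_cup i h _ ih => simp [ih]
  | comp_cap i h _ ih => simp [ih]

/-- Each cup meets its own mirror image in a circle, which has value `1`. -/
theorem IsCupWord.comp_mirror {m n : ℕ} {f : obj k m ⟶ obj k n} (h : IsCupWord k f) :
    f ≫ mirror f = 𝟙 _ := by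
  induction h with
  | id => simp
  | comp_cup i h _ ih =>
    rw [mirror_comp, mirror_cup, Category.assoc, ← Category.assoc (cup ..), cup_comp_cap_self,
      Category.id_comp, ih]

theorem IsCupWord.le {m n : ℕ} {f : obj k m ⟶ obj k n} (h : IsCupWord k f) : m ≤ n := by
  induction h with
  | id => exact le_rfl
  | comp_cup i h _ ih => omega

theorem IsCupWord.eq_id {n : ℕ} {f : obj k n ⟶ obj k n} (h : IsCupWord k f) : f = 𝟙 _ := by
  generalize hm : n = m at f
  cases h with
  | id => rfl
  | comp_cup i h h' => have := h'.le; omega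

/-- The morphism is zero or a composite of a cap word and a cup word. -/
def IsNormal {m n : ℕ} (f : obj k m ⟶ obj k n) : Prop :=
  f = 0 ∨ ∃ (l : ℕ) (c : obj k m ⟶ obj k l) (d : obj k l ⟶ obj k n),
    IsCapWord k c ∧ IsCupWord k d ∧ f = c ≫ d

theorem IsNormal.comp_cupWord {l m n : ℕ} {f : obj k l ⟶ obj k m} {g : obj k m ⟶ obj k n}
    (hf : IsNormal f) (hg : IsCupWord k g) : IsNormal (f ≫ g) := by
  obtain rfl | ⟨l, c, d, hc, hd, rfl⟩ := hf
  · exact Or.inl Limits.zero_comp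
  · exact Or.inr ⟨l, c, d ≫ g, hc, hd.comp hg, Category.assoc _ _ _⟩

theorem IsNormal.capWord_comp {l m n : ℕ} {f : obj k l ⟶ obj k m} {g : obj k m ⟶ obj k n}
    (hf : IsCapWord k f) (hg : IsNormal g) : IsNormal (f ≫ g) := by
  obtain rfl | ⟨l, c, d, hc, hd, rfl⟩ := hg
  · exact Or.inl Limits.comp_zero
  · exact Or.inr ⟨l, f ≫ c, d, hf.comp hc, hd, (Category.assoc _ _ _).symm⟩

/-- A cap after a cup cancels it, forms a vanishing zig-zag, or slides past it by interchange and
meets a shorter cup word. The equation `e` frees the codomain index for the induction. -/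
theorem IsCupWord.isNormal_comp_cap {m N : ℕ} {f : obj k m ⟶ obj k N} (hf : IsCupWord k f)
    (n i : ℕ) (h : i ≤ n) (e : N = n + 2) : IsNormal ((e ▸ f) ≫ cap k n i h) := by
  induction hf generalizing n i with
  | id =>
    subst e
    exact Or.inr ⟨_, _, _, isCapWord_cap n i h, .id _, by simp⟩
  | @comp_cup n' f j hj hf ih =>
    obtain rfl : n' = n := by omega
    change IsNormal ((f ≫ cup k n' j hj) ≫ cap k n' i h)
    rw [Category.assoc]
    obtain hij | rfl | rfl | rfl | hij : j + 2 ≤ i ∨ i = j + 1 ∨ i = j ∨ j = i + 1 ∨ i + 2 ≤ j := by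
      omega
    · obtain ⟨i, rfl⟩ : ∃ l, i = l + 2 := ⟨i - 2, by omega⟩
      obtain ⟨n, rfl⟩ : ∃ l, n' = l + 2 := ⟨n' - 2, by omega⟩
      rw [cup_comp_cap n j i (by omega) (by omega), ← Category.assoc]
      exact (ih n i (by omega) rfl).comp_cupWord (isCupWord_cup _ _ _)
    · rw [cup_comp_cap_succ, Limits.comp_zero]
      exact Or.inl rfl
    · rw [cup_comp_cap_self, Category.comp_id]
      exact Or.inr ⟨_, _, f, .id _, hf, by simp⟩
    · rw [cup_succ_comp_cap, Limits.comp_zero]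
      exact Or.inl rfl
    · obtain ⟨j, rfl⟩ : ∃ l, j = l + 2 := ⟨j - 2, by omega⟩
      obtain ⟨n, rfl⟩ : ∃ l, n' = l + 2 := ⟨n' - 2, by omega⟩
      rw [← cap_comp_cup n i j (by omega) (by omega), ← Category.assoc]
      exact (ih n i (by omega) rfl).comp_cupWord (isCupWord_cup _ _ _)

theorem IsWord.isNormal {m n : ℕ} {f : obj k m ⟶ obj k n} (hf : IsWord k f) : IsNormal f := by
  induction hf with
  | id => exact Or.inr ⟨_, _, _, .id _, .id _, by simp⟩
  | comp_cup i h _ ih => exact ih.comp_cupWord (isCupWord_cup _ _ _)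
  | comp_cap i h _ ih =>
    obtain rfl | ⟨l, c, d, hc, hd, rfl⟩ := ih
    · exact Or.inl Limits.zero_comp
    · rw [Category.assoc]
      exact IsNormal.capWord_comp hc (hd.isNormal_comp_cap _ i h rfl)

/-! ### The sign sequence of a cup word -/

/-- `f` sends the delta function of the constant sequence `+` to that of `w`. -/
def Hits {m n : ℕ} (f : obj k m ⟶ obj k n) (w : Signs) : Prop :=
  act f (Pi.single top 1) = Pi.single w 1

theorem hits_id (n : ℕ) : Hits (𝟙 (obj k n)) top := by
  rw [Hits, act_id]; rfl

theorem act_comp_apply {l m n : ℕ} (f : obj k l ⟶ obj k m) (g : obj k m ⟶ obj k n)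
    (F : Signs → k) : act (f ≫ g) F = act g (act f F) := by
  rw [act_comp]; rfl

theorem Hits.comp_cup {m n : ℕ} {f : obj k m ⟶ obj k n} {w : Signs} (h : Hits f w) (i : ℕ)
    (hi : i ≤ n) : Hits (f ≫ cup k n i hi) (ins i w) := by
  rw [Hits, act_comp_apply, h, act_cup_single]

theorem IsCupWord.exists_map {m n : ℕ} {f : obj k m ⟶ obj k n} (hf : IsCupWord k f) :
    ∃ φ : Signs → Signs, ∀ w, act f (Pi.single w 1) = Pi.single (φ w) 1 := by
  induction hf with
  | id => exact ⟨_root_.id, fun w => by rw [act_id]; rfl⟩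
  | comp_cup i h _ ih =>
    obtain ⟨φ, hφ⟩ := ih
    exact ⟨fun w => ins i (φ w), fun w => by rw [act_comp_apply, hφ, act_cup_single]⟩

theorem IsCupWord.exists_hits {m n : ℕ} {f : obj k m ⟶ obj k n} (hf : IsCupWord k f) :
    ∃ w, Hits f w :=
  let ⟨φ, hφ⟩ := hf.exists_map
  ⟨φ top, hφ top⟩

theorem IsWord.act_single {m n : ℕ} {f : obj k m ⟶ obj k n} (hf : IsWord k f) (w : Signs) :
    act f (Pi.single w 1) = 0 ∨ ∃ w', act f (Pi.single w 1) = Pi.single w' 1 := by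
  induction hf with
  | id => exact Or.inr ⟨w, by rw [act_id]; rfl⟩
  | comp_cup i h _ ih =>
    rw [act_comp_apply]
    obtain h' | ⟨w', h'⟩ := ih
    · rw [h', map_zero]; exact Or.inl rfl
    · rw [h', act_cup_single]; exact Or.inr ⟨_, rfl⟩
  | comp_cap i h _ ih =>
    rw [act_comp_apply]
    obtain h' | ⟨w', h'⟩ := ih
    · rw [h', map_zero]; exact Or.inl rfl
    · rw [h']
      by_cases hp : w'.Peak i
      · rw [← ins_del hp, act_cap_single_ins]; exact Or.inr ⟨_, rfl⟩
      · exact Or.inl (act_cap_single_of_not_peak _ _ _ hp)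

variable [Nontrivial k]

theorem single_injective {w w' : Signs} (h : (Pi.single w 1 : Signs → k) = Pi.single w' 1) :
    w = w' := by
  by_contra hw
  have := congrFun h w
  rw [Pi.single_eq_same, Pi.single_eq_of_ne hw] at this
  exact one_ne_zero this

theorem single_ne_zero (w : Signs) : (Pi.single w 1 : Signs → k) ≠ 0 := fun h =>
  one_ne_zero (α := k) (by simpa using congrFun h w)

theorem Hits.unique {m n : ℕ} {f : obj k m ⟶ obj k n} {w w' : Signs} (h : Hits f w)
    (h' : Hits f w') : w = w' := single_injective (h.symm.trans h')

theorem Hits.ne_zero {m n : ℕ} {f : obj k m ⟶ obj k n} {w : Signs} (h : Hits f w) : f ≠ 0 := by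
  rintro rfl
  rw [Hits, map_zero] at h
  exact single_ne_zero w h.symm

theorem IsCupWord.ne_zero {m n : ℕ} {f : obj k m ⟶ obj k n} (hf : IsCupWord k f) : f ≠ 0 :=
  let ⟨_, h⟩ := hf.exists_hits
  h.ne_zero

/-- A peak of the sign sequence of a cup word is an innermost cup. -/
theorem IsCupWord.exists_eq_comp_cup {m N : ℕ} {f : obj k m ⟶ obj k N} (hf : IsCupWord k f)
    {w : Signs} (hw : Hits f w) {i : ℕ} (hi : w.Peak i) :
    ∃ (n : ℕ) (h : i ≤ n) (g : obj k m ⟶ obj k n), IsCupWord k g ∧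
      (⟨N, f⟩ : Σ N, obj k m ⟶ obj k N) = ⟨n + 2, g ≫ cup k n i h⟩ := by
  induction hf generalizing w i with
  | id => exact absurd (hw.unique (hits_id _) ▸ hi) (not_peak_top i)
  | @comp_cup n f j hj hf ih =>
    obtain ⟨v, hv⟩ := hf.exists_hits
    obtain rfl := hw.unique (hv.comp_cup j hj)
    -- A peak of `ins j v` is the inserted pair itself or a peak of `v` away from it; in the latter
    -- case the two cups commute.
    obtain hij | rfl | rfl | rfl | hij : j + 2 ≤ i ∨ i = j + 1 ∨ i = j ∨ j = i + 1 ∨ i + 2 ≤ j := by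
      omega
    · obtain ⟨i, rfl⟩ : ∃ l, i = l + 2 := ⟨i - 2, by omega⟩
      rw [peak_ins_of_add_two_le hij] at hi
      obtain ⟨n, h, g, hg, e⟩ := ih hv hi
      obtain ⟨rfl, e⟩ := Sigma.mk.inj_iff.1 e
      obtain rfl := eq_of_heq e
      simp only [Nat.add_sub_cancel] at h
      refine ⟨n + 2, by omega, g ≫ cup k n j (by omega), hg.comp_cup _ _, ?_⟩
      rw [Category.assoc, Category.assoc, cup_comp_cup n j i (by omega) h]
      rfl
    · exact absurd hi (not_peak_ins_succ j v)
    · exact ⟨n, hj, f, hf, rfl⟩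
    · exact absurd hi (not_peak_ins_pred i v)
    · obtain ⟨j, rfl⟩ : ∃ l, j = l + 2 := ⟨j - 2, by omega⟩
      rw [peak_ins_of_lt (by omega)] at hi
      obtain ⟨n, h, g, hg, e⟩ := ih hv hi
      obtain ⟨rfl, e⟩ := Sigma.mk.inj_iff.1 e
      obtain rfl := eq_of_heq e
      refine ⟨n + 2, by omega, g ≫ cup k n j (by omega), hg.comp_cup _ _, ?_⟩
      rw [Category.assoc, Category.assoc, cup_comp_cup n i j (by omega) (by omega)]

/-- A cup word is determined by its codomain and its sign sequence. -/
theorem IsCupWord.eq_of_hits {m m' n : ℕ} {f : obj k m ⟶ obj k n} {f' : obj k m' ⟶ obj k n}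
    (hf : IsCupWord k f) (hf' : IsCupWord k f') {w : Signs} (hw : Hits f w) (hw' : Hits f' w) :
    (⟨m, f⟩ : Σ m, obj k m ⟶ obj k n) = ⟨m', f'⟩ := by
  induction hf generalizing m' w with
  | id =>
    cases hf' with
    | id => rfl
    | comp_cup i h hg =>
      obtain ⟨v, hv⟩ := hg.exists_hits
      exact absurd ((hw'.unique (hv.comp_cup i h)).symm.trans (hw.unique (hits_id _)))
        (ins_ne_top i v)
  | @comp_cup n f i h hf ih =>
    obtain ⟨v, hv⟩ := hf.exists_hits
    obtain rfl := hw.unique (hv.comp_cup i h)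
    -- The last cup of `f` gives a peak of the common sequence, so `f'` also ends with this cup, and
    -- both can be shortened.
    obtain ⟨n', h', g, hg, e⟩ := hf'.exists_eq_comp_cup hw' (peak_ins i v)
    obtain ⟨e', e⟩ := Sigma.mk.inj_iff.1 e
    obtain rfl : n = n' := by omega
    obtain rfl := eq_of_heq e
    obtain ⟨v', hv'⟩ := hg.exists_hits
    obtain rfl := ins_injective i (hw'.unique (hv'.comp_cup i h))
    obtain ⟨rfl, e⟩ := Sigma.mk.inj_iff.1 (ih hg hv hv')
    rw [eq_of_heq e]

end Words

end CrysTL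

namespace CrysTL

open Signs

/-! ### Words are determined by their action on sign sequences. -/

section Rigidity

variable {k : Type*} [CommRing k]

theorem IsCupWord.act_mirror_single {m n : ℕ} {f : obj k m ⟶ obj k n} (hf : IsCupWord k f)
    {w : Signs} (hw : Hits f w) : act (mirror f) (Pi.single w 1) = Pi.single top 1 := by
  rw [← hw, ← act_comp_apply, hf.comp_mirror, act_id]
  rfl

/-- The pair `(p, q)` serves below as the test position that detects this diagram. -/
theorem act_fac_single {l m n : ℕ} {b : obj k l ⟶ obj k m} {a : obj k l ⟶ obj k n}
    (hb : IsCupWord k b) {p q : Signs} (hp : Hits b p) (hq : Hits a q) :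
    act (mirror b ≫ a) (Pi.single p 1) = Pi.single q 1 := by
  rw [act_comp_apply, hb.act_mirror_single hp, hq]

theorem IsCupWord.fac_cancel {l m n : ℕ} {b : obj k l ⟶ obj k m} {a : obj k l ⟶ obj k n}
    (hb : IsCupWord k b) (ha : IsCupWord k a) : b ≫ (mirror b ≫ a) ≫ mirror a = 𝟙 _ := by
  rw [Category.assoc, ha.comp_mirror, Category.comp_id, hb.comp_mirror]

theorem IsWord.exists_fac {m n : ℕ} {f : obj k m ⟶ obj k n} (hf : IsWord k f) (h : f ≠ 0) :
    ∃ (l : ℕ) (a : obj k l ⟶ obj k n) (b : obj k l ⟶ obj k m), IsCupWord k a ∧ IsCupWord k b ∧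
      f = mirror b ≫ a := by
  obtain h' | ⟨l, c, d, hc, hd, e⟩ := hf.isNormal
  · exact absurd h' h
  · exact ⟨l, d, mirror c, hd, hc.mirrored, by rw [hc.isWord.mirror_mirror, e]⟩

/-- The constant sequence has no peak, so the first cap of a nontrivial mirror image kills it. -/
theorem IsCupWord.eq_of_act_mirror_top_ne_zero {m n : ℕ} {f : obj k m ⟶ obj k n}
    (hf : IsCupWord k f) (h : act (mirror f) (Pi.single top 1) ≠ 0) : m = n := by
  cases hf with
  | id => rfl
  | comp_cup i hi hf =>
    rw [mirror_comp, mirror_cup, act_comp_apply,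
      act_cap_single_of_not_peak _ _ _ (not_peak_top i), map_zero] at h
    exact absurd rfl h

/-- A word that does not kill the constant sequence `+` is a cup word. -/
theorem IsWord.isCupWord {m n : ℕ} {f : obj k m ⟶ obj k n} (hf : IsWord k f)
    (h : act f (Pi.single top 1) ≠ 0) : IsCupWord k f := by
  obtain ⟨l, a, b, ha, hb, rfl⟩ := hf.exists_fac (by rintro rfl; simp at h)
  rw [act_comp_apply] at h
  obtain rfl := hb.eq_of_act_mirror_top_ne_zero fun h' => h (by rw [h', map_zero])
  rw [hb.eq_id, mirror_id, Category.id_comp]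
  exact ha

/-- A cap followed by the same cup removes and restores one pair `+-`, so it only restricts a
function to the sequences with that peak. Such multiplication operators commute, which makes the
idempotents of `T_n` commute. -/
theorem IsCupWord.exists_act_mirror_comp {m n : ℕ} {f : obj k m ⟶ obj k n}
    (hf : IsCupWord k f) : ∃ χ : Signs → k, ∀ F, act (mirror f ≫ f) F = χ * F := by
  induction hf with
  | id => exact ⟨1, fun F => by rw [mirror_id, Category.id_comp, act_id, one_mul]; rfl⟩
  | comp_cup i h hf ih =>
    obtain ⟨χ, hχ⟩ := ih
    -- The new multiplier is the old one evaluated after deleting the pair at `i`, and zero where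
    -- there is no such peak.
    refine ⟨cupEnd k i χ, fun F => ?_⟩
    rw [mirror_comp, mirror_cup, Category.assoc, act_comp_apply, ← Category.assoc, act_comp_apply,
      hχ, act_cap, act_cup]
    funext w
    by_cases hw : w.Peak i <;> simp [cupEnd_apply, capEnd_apply, hw, ins_del]

variable [Nontrivial k]

theorem IsCupWord.hits_of_act_mirror {m n : ℕ} {f : obj k m ⟶ obj k n} (hf : IsCupWord k f)
    {w : Signs} (h : act (mirror f) (Pi.single w 1) = Pi.single top 1) : Hits f w := by
  induction hf generalizing w with
  | id =>
    rw [mirror_id, act_id] at h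
    exact single_injective (k := k) h ▸ hits_id _
  | comp_cup i hi hf ih =>
    rw [mirror_comp, mirror_cup, act_comp_apply] at h
    by_cases hp : w.Peak i
    · rw [← ins_del hp, act_cap_single_ins] at h
      rw [← ins_del hp]
      exact (ih h).comp_cup i hi
    · rw [act_cap_single_of_not_peak _ _ _ hp, map_zero] at h
      exact absurd h.symm (single_ne_zero _)

/-- A word undone by `g` acts injectively, so it does not kill the constant sequence. -/
theorem IsWord.isCupWord_of_comp_eq_id {m n : ℕ} {f : obj k m ⟶ obj k n} {g : obj k n ⟶ obj k m}
    (hf : IsWord k f) (h : f ≫ g = 𝟙 _) : IsCupWord k f := by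
  refine hf.isCupWord fun h' => single_ne_zero (k := k) top ?_
  have : act (f ≫ g) (Pi.single top (1 : k)) = 0 := by rw [act_comp_apply, h', map_zero]
  rw [h, act_id] at this
  exact this

/-- The composite sends the constant sequence to `q`, so it is a cup word, and cup words are
determined by their sequence. -/
theorem comp_eq_of_act_eq {l l' m n : ℕ} {x : obj k m ⟶ obj k n} (hx : IsWord k x)
    {b : obj k l ⟶ obj k m} {a : obj k l' ⟶ obj k n} (hb : IsCupWord k b) (ha : IsCupWord k a)
    {p q : Signs} (hp : Hits b p) (hq : Hits a q)
    (h : act x (Pi.single p 1) = Pi.single q 1) :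
    (⟨l, b ≫ x⟩ : Σ l, obj k l ⟶ obj k n) = ⟨l', a⟩ := by
  have h' : Hits (b ≫ x) q := by rw [Hits, act_comp_apply, hp, h]
  refine IsCupWord.eq_of_hits ?_ ha h' hq
  refine (hb.isWord.comp hx).isCupWord ?_
  rw [h']
  exact single_ne_zero q

/-- Composition cannot increase the number of through-strands: cancelling the outer cups leaves a
word from `[l]` to `[l']` that is undone by another morphism, hence a cup word. -/
theorem fac_le {l l' m n m' n' : ℕ} {b : obj k l ⟶ obj k m} {a : obj k l ⟶ obj k n}
    {b' : obj k l' ⟶ obj k m'} {a' : obj k l' ⟶ obj k n'} (hb : IsCupWord k b)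
    (ha : IsCupWord k a) (hb' : IsCupWord k b')
    {g : obj k m ⟶ obj k m'} {g' : obj k n' ⟶ obj k n} (hg : IsWord k g)
    (h : mirror b ≫ a = g ≫ (mirror b' ≫ a') ≫ g') : l ≤ l' := by
  have h' : (b ≫ g ≫ mirror b') ≫ a' ≫ g' ≫ mirror a = 𝟙 _ := by
    rw [← hb.fac_cancel ha, h]
    simp only [Category.assoc]
  exact ((hb.isWord.comp (hg.comp hb'.isWord.mirrored)).isCupWord_of_comp_eq_id h').le

/-- The factorization of a nonzero word is unique. -/
theorem fac_unique {l l' m n : ℕ} {b : obj k l ⟶ obj k m} {a : obj k l ⟶ obj k n}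
    {b' : obj k l' ⟶ obj k m} {a' : obj k l' ⟶ obj k n} (hb : IsCupWord k b)
    (ha : IsCupWord k a) (hb' : IsCupWord k b') (ha' : IsCupWord k a')
    (h : act (mirror b ≫ a) = act (mirror b' ≫ a')) :
    (⟨l, a, b⟩ : Σ l, (obj k l ⟶ obj k n) × (obj k l ⟶ obj k m)) = ⟨l', a', b'⟩ := by
  -- Applied in both directions, this forces equal numbers of through-strands; the comparison `b ≫
  -- mirror b'` is then the identity.
  have key {l l'} {b : obj k l ⟶ obj k m} {a : obj k l ⟶ obj k n} {b' : obj k l' ⟶ obj k m}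
      {a' : obj k l' ⟶ obj k n} (hb : IsCupWord k b) (ha : IsCupWord k a)
      (hb' : IsCupWord k b') (ha' : IsCupWord k a')
      (h : act (mirror b ≫ a) = act (mirror b' ≫ a')) :
      b ≫ mirror b' ≫ a' = a ∧ IsCupWord k (b ≫ mirror b') := by
    obtain ⟨p, hp⟩ := hb.exists_hits
    obtain ⟨q, hq⟩ := ha.exists_hits
    have h₁ := act_fac_single hb hp hq
    rw [h] at h₁
    have h₂ := eq_of_heq (Sigma.mk.inj_iff.1
      (comp_eq_of_act_eq (hb'.mirrored.isWord.comp ha'.isWord) hb ha hp hq h₁)).2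
    refine ⟨h₂, (hb.isWord.comp hb'.mirrored.isWord).isCupWord_of_comp_eq_id
      (g := a' ≫ mirror a) ?_⟩
    rw [Category.assoc, ← Category.assoc _ a', ← Category.assoc b, h₂, ha.comp_mirror]
  obtain ⟨h₁, h₂⟩ := key hb ha hb' ha' h
  obtain ⟨-, h₃⟩ := key hb' ha' hb ha h.symm
  obtain rfl := le_antisymm h₂.le h₃.le
  have h₄ := h₂.eq_id
  have h₅ : a' = a := by
    rw [← h₁, ← Category.assoc, h₄, Category.id_comp]
  obtain ⟨p, hp⟩ := hb.exists_hits
  have h₆ : Hits b' p := by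
    refine hb'.hits_of_act_mirror ?_
    rw [← hp, ← act_comp_apply, h₄, act_id]
    rfl
  have h₇ := eq_of_heq (Sigma.mk.inj_iff.1 (hb.eq_of_hits hb' hp h₆)).2
  rw [h₅, h₇]

theorem fac_ne_zero {l m n : ℕ} {b : obj k l ⟶ obj k m} {a : obj k l ⟶ obj k n}
    (hb : IsCupWord k b) (ha : IsCupWord k a) : act (mirror b ≫ a) ≠ 0 := fun h => by
  obtain ⟨p, hp⟩ := hb.exists_hits
  obtain ⟨q, hq⟩ := ha.exists_hits
  have := act_fac_single hb hp hq
  rw [h] at this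
  exact single_ne_zero q this.symm

/-- A nonzero word acts nontrivially and its factorization can be recovered from the action.
Identities in `T_n` can therefore be checked on sign sequences. -/
theorem IsWord.eq_of_act_eq {m n : ℕ} {f g : obj k m ⟶ obj k n} (hf : IsWord k f)
    (hg : IsWord k g) (h : act f = act g) : f = g := by
  by_cases hf0 : f = 0
  · by_contra hg0
    obtain ⟨l, a, b, ha, hb, rfl⟩ := hg.exists_fac fun e => hg0 (hf0.trans e.symm)
    rw [hf0, map_zero] at h
    exact fac_ne_zero hb ha h.symm
  · obtain ⟨l, a, b, ha, hb, rfl⟩ := hf.exists_fac hf0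
    by_cases hg0 : g = 0
    · rw [hg0, map_zero] at h
      exact absurd h (fac_ne_zero hb ha)
    · obtain ⟨l', a', b', ha', hb', rfl⟩ := hg.exists_fac hg0
      obtain ⟨rfl, e⟩ := Sigma.mk.inj_iff.1 (fac_unique hb ha hb' ha' h)
      obtain ⟨rfl, rfl⟩ := Prod.mk_inj.1 (eq_of_heq e)
      rfl

end Rigidity

/-! ### The monoid `T_n` -/

section Monoid

variable {k : Type*} [CommRing k] {n : ℕ}

@[simp] theorem T.coe_zero : ((0 : T k n) : End (obj k n)) = 0 := rfl

/-- The product in `End` composes from right to left, while `≫` composes from left to right. -/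
theorem T.coe_mul (x y : T k n) :
    ((x * y : T k n) : End (obj k n)) = (y : End (obj k n)) ≫ (x : End (obj k n)) := rfl

theorem T.isWord {x : T k n} (hx : x ≠ 0) :
    IsWord k (m := n) (n := n) (x : End (obj k n)) :=
  (x.2.resolve_left fun h => hx (Subtype.ext h)).2

theorem T.coe_ne_zero {x : T k n} (hx : x ≠ 0) : (x : End (obj k n)) ≠ 0 := fun h =>
  hx (Subtype.ext h)

theorem T.act_single (x : T k n) (w : Signs) :
    act (m := n) (n := n) (x : End (obj k n)) (Pi.single w 1) = 0 ∨
      ∃ w', act (m := n) (n := n) (x : End (obj k n)) (Pi.single w 1) = Pi.single w' 1 := by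
  by_cases hx : x = 0
  · subst hx; left; rw [T.coe_zero, map_zero]; rfl
  · exact (T.isWord hx).act_single w

/-- The element of `T_n` given by a word. -/
def T.ofWord {f : obj k n ⟶ obj k n} (hf : IsWord k f) : T k n :=
  ⟨f, or_iff_not_imp_left.2 fun h => ⟨h, hf⟩⟩

/-- The element `a ∘ b̄` of `T_n`, for cup words `a`, `b`. -/
noncomputable def T.ofCups {j : ℕ} {a b : obj k j ⟶ obj k n} (ha : IsCupWord k a)
    (hb : IsCupWord k b) : T k n :=
  T.ofWord (hb.mirrored.isWord.comp ha.isWord)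

theorem T.coe_ofCups {j : ℕ} {a b : obj k j ⟶ obj k n} (ha : IsCupWord k a)
    (hb : IsCupWord k b) : (T.ofCups ha hb : End (obj k n)) = mirror b ≫ a := rfl

/-- The inner cups close up to circles of value `1`, so diagrams with matching inner cups multiply
like matrix units. -/
theorem T.ofCups_mul {j : ℕ} {a b c : obj k j ⟶ obj k n} (ha : IsCupWord k a)
    (hb : IsCupWord k b) (hc : IsCupWord k c) :
    T.ofCups ha hb * T.ofCups hb hc = T.ofCups ha hc := by
  refine Subtype.ext ?_
  rw [T.coe_mul, T.coe_ofCups, T.coe_ofCups, T.coe_ofCups, Category.assoc, ← Category.assoc b,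
    hb.comp_mirror, Category.id_comp]

theorem T.exists_ofCups {x : T k n} (hx : x ≠ 0) :
    ∃ (j : ℕ) (a b : obj k j ⟶ obj k n) (ha : IsCupWord k a) (hb : IsCupWord k b),
      x = T.ofCups ha hb := by
  obtain ⟨j, a, b, ha, hb, e⟩ := (T.isWord hx).exists_fac (T.coe_ne_zero hx)
  exact ⟨j, a, b, ha, hb, Subtype.ext e⟩

variable [Nontrivial k]

theorem T.ofCups_ne_zero {j : ℕ} {a b : obj k j ⟶ obj k n} (ha : IsCupWord k a)
    (hb : IsCupWord k b) : T.ofCups ha hb ≠ 0 := fun h =>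
  fac_ne_zero hb ha (by rw [← T.coe_ofCups ha hb, h, T.coe_zero]; exact map_zero _)

theorem T.ofCups_injective {j j' : ℕ} {a b : obj k j ⟶ obj k n} {a' b' : obj k j' ⟶ obj k n}
    {ha : IsCupWord k a} {hb : IsCupWord k b} {ha' : IsCupWord k a'} {hb' : IsCupWord k b'}
    (h : T.ofCups ha hb = T.ofCups ha' hb') :
    (⟨j, a, b⟩ : Σ l, (obj k l ⟶ obj k n) × (obj k l ⟶ obj k n)) = ⟨j', a', b'⟩ := by
  have h' : mirror b ≫ a = mirror b' ≫ a' := congrArg Subtype.val h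
  exact fac_unique hb ha hb' ha' (by rw [h'])

theorem T.ext_act {x y : T k n}
    (h : act (m := n) (n := n) (x : End (obj k n)) = act (m := n) (n := n) (y : End (obj k n))) :
    x = y := by
  have key {x y : T k n} (hx : x = 0) (h : act (m := n) (n := n) (x : End (obj k n)) =
      act (m := n) (n := n) (y : End (obj k n))) : x = y := by
    by_contra hy
    obtain ⟨j, a, b, ha, hb, rfl⟩ := T.exists_ofCups (x := y) (hx ▸ Ne.symm hy)
    refine fac_ne_zero hb ha ?_
    rw [← T.coe_ofCups ha hb, ← h, hx, T.coe_zero]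
    exact map_zero _
  by_cases hx : x = 0
  · exact key hx h
  by_cases hy : y = 0
  · exact (key hy h.symm).symm
  · exact Subtype.ext ((T.isWord hx).eq_of_act_eq (T.isWord hy) h)

/-- Sandwiching `x * x = x` between `b` and `mirror a` gives `a ≫ mirror b = 𝟙`, so `a` and `b` have
the same sign sequence. -/
theorem T.exists_of_isIdempotentElem {x : T k n} (hx : x ≠ 0) (h : IsIdempotentElem x) :
    ∃ (j : ℕ) (a : obj k j ⟶ obj k n) (ha : IsCupWord k a), x = T.ofCups ha ha := by
  obtain ⟨j, a, b, ha, hb, rfl⟩ := T.exists_ofCups hx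
  have h₁ : (mirror b ≫ a) ≫ mirror b ≫ a = mirror b ≫ a := congrArg Subtype.val h
  have h₂ : a ≫ mirror b = 𝟙 _ := by
    rw [← hb.fac_cancel ha, ← h₁]
    simp only [Category.assoc]
    rw [ha.comp_mirror, Category.comp_id, ← Category.assoc b, hb.comp_mirror, Category.id_comp]
  obtain ⟨p, hp⟩ := ha.exists_hits
  have h₃ : Hits b p := by
    refine hb.hits_of_act_mirror ?_
    rw [← hp, ← act_comp_apply, h₂, act_id]
    rfl
  obtain rfl := eq_of_heq (Sigma.mk.inj_iff.1 (ha.eq_of_hits hb hp h₃)).2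
  exact ⟨j, a, ha, rfl⟩

theorem T.exists_act_of_isIdempotentElem {x : T k n} (h : IsIdempotentElem x) :
    ∃ χ : Signs → k, ∀ F, act (m := n) (n := n) (x : End (obj k n)) F = χ * F := by
  by_cases hx : x = 0
  · refine ⟨0, fun F => ?_⟩
    rw [hx, T.coe_zero, zero_mul]
    exact congrArg (· F) (map_zero (act (k := k) (m := n) (n := n)))
  · obtain ⟨j, a, ha, rfl⟩ := T.exists_of_isIdempotentElem hx h
    exact ha.exists_act_mirror_comp

theorem T.commute_of_isIdempotentElem {x y : T k n} (hx : IsIdempotentElem x)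
    (hy : IsIdempotentElem y) : x * y = y * x := by
  obtain ⟨χ, hχ⟩ := T.exists_act_of_isIdempotentElem hx
  obtain ⟨ψ, hψ⟩ := T.exists_act_of_isIdempotentElem hy
  refine T.ext_act (LinearMap.ext fun F => ?_)
  rw [T.coe_mul, T.coe_mul, act_comp_apply, act_comp_apply, hχ, hψ, hχ, hψ, mul_left_comm]

/-- Exchanging `a` and `b` gives an inverse; its uniqueness is the standard consequence of commuting
idempotents. -/
instance T.instIsInverse : InvMon.IsInverse (T k n) where
  existsUnique_inv s := by
    refine existsUnique_of_exists_of_unique ?_ ?_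
    · by_cases hs : s = 0
      · exact ⟨0, by simp [hs], by simp⟩
      · obtain ⟨j, a, b, ha, hb, rfl⟩ := T.exists_ofCups hs
        exact ⟨T.ofCups hb ha, by simp only [T.ofCups_mul], by simp only [T.ofCups_mul]⟩
    · rintro t t' ⟨h₁, h₂⟩ ⟨h₁', h₂'⟩
      have i₁ : IsIdempotentElem (s * t) := by rw [IsIdempotentElem, ← mul_assoc, ← h₁]
      have i₂ : IsIdempotentElem (s * t') := by rw [IsIdempotentElem, ← mul_assoc, ← h₁']
      have i₃ : IsIdempotentElem (t * s) := by rw [IsIdempotentElem, ← mul_assoc, ← h₂]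
      have i₄ : IsIdempotentElem (t' * s) := by rw [IsIdempotentElem, ← mul_assoc, ← h₂']
      calc t = t * (s * t) := by rw [← mul_assoc, ← h₂]
        _ = t * ((s * t' * s) * t) := by rw [← h₁']
        _ = t * ((s * t') * (s * t)) := by simp only [mul_assoc]
        _ = t * ((s * t) * (s * t')) := by rw [T.commute_of_isIdempotentElem i₁ i₂]
        _ = (t * s * t) * s * t' := by simp only [mul_assoc]
        _ = t * s * t' := by rw [← h₂]
        _ = t * s * (t' * s * t') := by rw [← h₂']
        _ = (t * s) * (t' * s) * t' := by simp only [mul_assoc]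
        _ = (t' * s) * (t * s) * t' := by rw [T.commute_of_isIdempotentElem i₃ i₄]
        _ = t' * (s * t * s) * t' := by simp only [mul_assoc]
        _ = t' := by rw [← h₁, ← h₂']

theorem T.inv_ofCups {j : ℕ} {a b : obj k j ⟶ obj k n} (ha : IsCupWord k a)
    (hb : IsCupWord k b) : InvMon.inv (T.ofCups ha hb) = T.ofCups hb ha := by
  refine InvMon.inv_unique (InvMon.mul_inv_mul _) (InvMon.inv_mul_inv _) ?_ ?_ <;>
    simp only [T.ofCups_mul]

/-- An idempotent acts diagonally, so it cannot move `p`; this gives one direction. Conversely, `y`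
sending `p` to `q` forces `b ≫ y = a`, so restricting `y` to the idempotent of `b` gives the
diagram. -/
theorem T.natLE_iff {j : ℕ} {a b : obj k j ⟶ obj k n} (ha : IsCupWord k a) (hb : IsCupWord k b)
    {p q : Signs} (hp : Hits b p) (hq : Hits a q) (y : T k n) :
    InvMon.NatLE (T.ofCups ha hb) y ↔
      act (m := n) (n := n) (y : End (obj k n)) (Pi.single p 1) = Pi.single q 1 := by
  constructor
  · rintro ⟨e, he, h⟩
    have h₁ := act_fac_single hb hp hq
    rw [← T.coe_ofCups ha hb, h, T.coe_mul, act_comp_apply] at h₁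
    obtain ⟨χ, hχ⟩ := T.exists_act_of_isIdempotentElem he
    have h₂ : act (m := n) (n := n) (e : End (obj k n)) (Pi.single p 1) = χ p • Pi.single p 1 := by
      rw [hχ]
      funext w
      by_cases hw : w = p <;> simp [hw]
    obtain h₃ | ⟨w, h₃⟩ := T.act_single e p
    · rw [h₃, map_zero] at h₁
      exact absurd h₁.symm (single_ne_zero q)
    · have h₄ : w = p := by
        by_contra hw
        have := congrFun (h₃.symm.trans h₂) w
        simp [hw] at this
      rwa [h₃, h₄] at h₁
  · intro h
    refine ⟨T.ofCups hb hb, by rw [IsIdempotentElem, T.ofCups_mul], Subtype.ext ?_⟩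
    have hy : y ≠ 0 := by
      rintro rfl
      rw [T.coe_zero] at h
      rw [map_zero (act (k := k) (m := n) (n := n))] at h
      exact single_ne_zero q h.symm
    have := eq_of_heq (Sigma.mk.inj_iff.1 (comp_eq_of_act_eq (T.isWord hy) hb ha hp hq h)).2
    rw [T.coe_mul, T.coe_ofCups, T.coe_ofCups, Category.assoc, this]

end Monoid

end CrysTL

/-! ### The natural order of an inverse monoid and Möbius inversion. -/

namespace InvMon

section Monoid

variable {M : Type*} [Monoid M]

theorem mem_lower [Finite M] {s t : M} : t ∈ lower s ↔ NatLE t s := by simp [lower]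

theorem self_mem_lower [Finite M] (s : M) : s ∈ lower s :=
  mem_lower.2 ⟨1, IsIdempotentElem.one, (mul_one s).symm⟩

theorem sum_coeff_smul_of {k : Type*} [CommRing k] [Fintype M] (a : MonoidAlgebra k M) :
    ∑ y, a.coeff y • MonoidAlgebra.of k M y = a := by
  conv_rhs => rw [← a.sum_coeff_single, Finsupp.sum_fintype _ _ (by simp)]
  simp

end Monoid

section Order

variable {M : Type*} [Monoid M] [IsInverse M]

theorem inv_eq_self {e : M} (he : IsIdempotentElem e) : inv e = e :=
  inv_unique (mul_inv_mul _) (inv_mul_inv _) (by rw [he.eq, he.eq]) (by rw [he.eq, he.eq])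

theorem inv_mul_rev (s t : M) : inv (s * t) = inv t * inv s := by
  refine inv_unique (mul_inv_mul _) (inv_mul_inv _) ?_ ?_
  · calc s * t * (inv t * inv s) * (s * t) = s * ((t * inv t) * (inv s * s)) * t := by
          simp only [mul_assoc]
      _ = s * ((inv s * s) * (t * inv t)) * t := by
          rw [idem_comm (idem_mul_inv t) (idem_inv_mul s)]
      _ = (s * inv s * s) * (t * inv t * t) := by simp only [mul_assoc]
      _ = s * t := by rw [mul_inv_mul, mul_inv_mul]
  · calc inv t * inv s * (s * t) * (inv t * inv s)
        = inv t * ((inv s * s) * (t * inv t)) * inv s := by simp only [mul_assoc]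
      _ = inv t * ((t * inv t) * (inv s * s)) * inv s := by
          rw [idem_comm (idem_mul_inv t) (idem_inv_mul s)]
      _ = (inv t * t * inv t) * (inv s * s * inv s) := by simp only [mul_assoc]
      _ = inv t * inv s := by rw [inv_mul_inv, inv_mul_inv]

/-- An element below `x` is the restriction of `x` to its own domain idempotent, hence determined by
that idempotent. -/
theorem natLE_iff_eq_mul {a x : M} : NatLE a x ↔ a = x * (inv a * a) := by
  refine ⟨?_, fun h => ⟨_, idem_inv_mul a, h⟩⟩
  rintro ⟨e, he, rfl⟩
  rw [inv_mul_rev, inv_eq_self he]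
  calc x * e = x * inv x * x * e := by rw [mul_inv_mul]
    _ = x * (inv x * x * (e * e)) := by rw [he.eq]; simp only [mul_assoc]
    _ = x * (e * e * (inv x * x)) := by rw [idem_comm (idem_inv_mul x) (idem_mul he he)]
    _ = x * (e * ((inv x * x) * e)) := by
        rw [idem_comm (idem_inv_mul x) he]; simp only [mul_assoc]
    _ = x * (e * inv x * (x * e)) := by simp only [mul_assoc]

variable [Finite M]

open Classical in
theorem sum_mobius (z x : M) :
    (∑ t ∈ lower x, if NatLE z t then mobius t x else 0) = if z = x then 1 else 0 := by
  let := natOrder M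
  let := Fintype.ofFinite M
  let : LocallyFiniteOrder M := Fintype.toLocallyFiniteOrder
  rw [← Finset.sum_filter]
  convert! IncidenceAlgebra.sum_Icc_mu_left (𝕜 := ℤ) z x using 1
  refine Finset.sum_congr ?_ fun _ _ => rfl
  ext t
  rw [Finset.mem_filter, mem_lower, Finset.mem_Icc, and_comm]
  rfl

/-- Möbius inversion for the natural partial order. -/
theorem sum_mobius_smul {k A : Type*} [CommRing k] [AddCommGroup A] [Module k A] {f g : M → A}
    (h : ∀ x, g x = ∑ y ∈ lower x, f y) (x : M) :
    ∑ t ∈ lower x, (mobius t x : k) • g t = f x := by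
  classical
  have h₁ : ∀ t ∈ lower x, (mobius t x : k) • g t =
      ∑ z ∈ lower x, ((if NatLE z t then mobius t x else 0 : ℤ) : k) • f z := by
    intro t ht
    rw [h, Finset.smul_sum]
    have : lower t = (lower x).filter (NatLE · t) := by
      let := natOrder M
      ext z
      rw [Finset.mem_filter, mem_lower, mem_lower]
      exact ⟨fun hz => ⟨le_trans (α := M) hz (mem_lower.1 ht), hz⟩, fun hz => hz.2⟩
    rw [this, Finset.sum_filter]
    refine Finset.sum_congr rfl fun z _ => ?_
    split_ifs <;> simp
  rw [Finset.sum_congr rfl h₁, Finset.sum_comm]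
  simp_rw [← Finset.sum_smul, ← Int.cast_sum, sum_mobius]
  simp [self_mem_lower]

open Classical in
/-- A function which vanishes wherever its sum over the upper set does not vanish is zero. -/
theorem eq_zero_of_sum_upper_eq_zero {A : Type*} [AddCommGroup A] [Fintype M] {a : M → A}
    (h : ∀ x, a x = 0 ∨ ∑ y, (if NatLE x y then a y else 0) = 0) (x : M) : a x = 0 := by
  let := natOrder M
  by_contra hx
  -- At a maximal element of the support, the sum over the upper set reduces to a single term.
  obtain ⟨m, hm⟩ := (Set.toFinite {x | a x ≠ 0}).exists_maximal ⟨x, hx⟩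
  refine hm.prop ((h m).resolve_left hm.prop ▸ ?_)
  rw [Finset.sum_eq_single m]
  · exact (if_pos (le_refl m)).symm
  · intro y _ hy
    split_ifs with hmy
    · by_contra hay
      exact hy (le_antisymm (hm.le_of_ge hay hmy) hmy)
    · rfl
  · simp

end Order

/-! ### The algebra of a finite inverse monoid as a product of matrix algebras. -/

section Matrices

variable {M : Type*} [Monoid M] [IsInverse M] (k : Type*) [CommRing k]

open Classical in
theorem matrixUnit_apply (x : M) (J : JCell M) (r c : CellIdem J) :
    matrixUnit k x J r c = if x * inv x = r.1 ∧ inv x * x = c.1 then 1 else 0 := by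
  by_cases hJ : cell x = J
  · subst hJ
    rw [matrixUnit, Pi.single_eq_same, Matrix.single_apply]
    simp only [Subtype.ext_iff]
  · rw [matrixUnit, Pi.single_eq_of_ne (Ne.symm hJ), if_neg]
    · rfl
    · rintro ⟨h, -⟩
      exact hJ (by rw [← cell_mul_inv, h, r.2.2])

/-- The idempotent `c` is the domain and `r` is the range of the restriction `x c` of `x`. -/
def Carries (x r c : M) : Prop := x * c * inv (x * c) = r ∧ inv (x * c) * (x * c) = c

/-- The intermediate idempotent is the range of the restriction `y c`; it plays the role of the
summation index in a matrix product. -/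
theorem carries_mul {x y r c : M} :
    Carries (x * y) r c ↔ ∃ g, IsIdempotentElem g ∧ Carries x r g ∧ Carries y g c := by
  constructor
  · rintro ⟨h₁, h₂⟩
    obtain ⟨b, hb⟩ : ∃ b, b = y * c := ⟨_, rfl⟩
    have hc : IsIdempotentElem c := h₂ ▸ idem_inv_mul _
    have hbc : b * c = b := by rw [hb, mul_assoc, hc.eq]
    rw [mul_assoc x y c, ← hb, inv_mul_rev] at h₁ h₂
    have h₃ : inv b * b = c := by
      calc inv b * b = inv b * b * c := by rw [mul_assoc, hbc]
        _ = (inv b * b * inv b) * inv x * (x * b) := by rw [← h₂]; simp only [mul_assoc]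
        _ = c := by rw [inv_mul_inv, h₂]
    have hg : IsIdempotentElem (b * inv b) := idem_mul_inv b
    refine ⟨b * inv b, hg, ⟨?_, ?_⟩, by rw [← hb], by rw [← hb, h₃]⟩
    · rw [inv_mul_rev, inv_eq_self hg]
      calc x * (b * inv b) * (b * inv b * inv x) = x * (b * inv b * b) * (inv b * inv x) := by
            simp only [mul_assoc]
        _ = r := by rw [mul_inv_mul, h₁]
    · rw [inv_mul_rev, inv_eq_self hg]
      calc b * inv b * inv x * (x * (b * inv b)) = b * (inv b * inv x * (x * b)) * inv b := by
            simp only [mul_assoc]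
        _ = b * inv b := by rw [h₂, hbc]
  · rintro ⟨g, hg, ⟨h₁, h₂⟩, h₃, h₄⟩
    rw [inv_mul_rev, inv_eq_self hg] at h₁ h₂
    rw [Carries, mul_assoc x]
    obtain ⟨b, hb⟩ : ∃ b, b = y * c := ⟨_, rfl⟩
    rw [← hb] at h₃ h₄ ⊢
    have hgb : g * b = b := by rw [← h₃, mul_inv_mul]
    rw [inv_mul_rev]
    constructor
    · calc x * b * (inv b * inv x) = x * (b * inv b) * inv x := by simp only [mul_assoc]
        _ = x * (g * g) * inv x := by rw [h₃, hg.eq]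
        _ = x * g * (g * inv x) := by simp only [mul_assoc]
        _ = r := h₁
    · have hbg : inv b * g = inv b := by rw [← h₃, ← mul_assoc, inv_mul_inv]
      calc inv b * inv x * (x * b) = inv b * g * inv x * (x * (g * b)) := by rw [hbg, hgb]
        _ = inv b * (g * inv x * (x * g)) * b := by simp only [mul_assoc]
        _ = c := by rw [h₂, hbg, h₄]

theorem Carries.cell_eq {x r c : M} (h : Carries x r c) : cell r = cell c := by
  rw [← h.1, cell_mul_inv, ← cell_inv_mul, h.2]

theorem Carries.left_unique {x r r' c : M} (h : Carries x r c) (h' : Carries x r' c) : r = r' :=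
  h.1.symm.trans h'.1

variable [Finite M]

/-- The sum of the matrix units of the elements below `x`. -/
noncomputable def lowerSum (x : M) : ∀ J : JCell M, Matrix (CellIdem J) (CellIdem J) k :=
  ∑ y ∈ lower x, matrixUnit k y

open Classical in
theorem lowerSum_apply (x : M) (J : JCell M) (r c : CellIdem J) :
    lowerSum k x J r c = if Carries x r.1 c.1 then 1 else 0 := by
  rw [lowerSum, Finset.sum_apply, Matrix.sum_apply]
  simp_rw [matrixUnit_apply]
  -- Only the restriction of `x` to the column idempotent can contribute.
  rw [Finset.sum_eq_single (x * c.1)]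
  · exact if_congr Iff.rfl rfl rfl
  · intro y hy hne
    refine if_neg fun h => hne ?_
    rw [natLE_iff_eq_mul.1 (mem_lower.1 hy), h.2]
  · exact fun h => absurd (mem_lower.2 ⟨c.1, c.2.1, rfl⟩) h

/-- The sums of the matrix units of the elements below `x`, as a representation of `M`. -/
noncomputable def lowerSumHom : M →* ∀ J : JCell M, Matrix (CellIdem J) (CellIdem J) k where
  toFun := lowerSum k
  map_one' := by
    classical
    funext J
    ext r c
    rw [lowerSum_apply, Pi.one_apply, Matrix.one_apply]
    congr 1
    rw [Carries, one_mul, inv_eq_self c.2.1, c.2.1.eq, Subtype.ext_iff, eq_iff_iff]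
    exact ⟨fun h => h.1.symm, fun h => ⟨h.symm, rfl⟩⟩
  map_mul' x y := by
    classical
    funext J
    ext r c
    rw [Pi.mul_apply, Matrix.mul_apply]
    simp_rw [lowerSum_apply]
    by_cases h : Carries (x * y) r.1 c.1
    · rw [if_pos h]
      obtain ⟨g, hg, h₁, h₂⟩ := carries_mul.1 h
      rw [Finset.sum_eq_single ⟨g, hg, h₂.cell_eq.trans c.2.2⟩]
      · rw [if_pos h₁, if_pos h₂, one_mul]
      · intro g' _ hg'
        rw [if_neg (c := Carries y g'.1 c.1), mul_zero]
        exact fun h' => hg' (Subtype.ext (h'.left_unique h₂))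
      · simp
    · rw [if_neg h]
      refine (Finset.sum_eq_zero fun g _ => ?_).symm
      by_cases h₁ : Carries x r.1 g.1
      · rw [if_neg (c := Carries y g.1 c.1), mul_zero]
        exact fun h₂ => h (carries_mul.2 ⟨g.1, g.2.1, h₁, h₂⟩)
      · rw [if_neg h₁, zero_mul]

/-- The representation of the monoid algebra by sums of matrix units. -/
noncomputable def lowerSumAlgHom :
    MonoidAlgebra k M →ₐ[k] ∀ J : JCell M, Matrix (CellIdem J) (CellIdem J) k :=
  MonoidAlgebra.lift k _ M (lowerSumHom k)

theorem lowerSumAlgHom_of (x : M) :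
    lowerSumAlgHom k (MonoidAlgebra.of k M x) = ∑ y ∈ lower x, matrixUnit k y :=
  MonoidAlgebra.lift_of _ _

theorem lowerSumAlgHom_bracket (x : M) : lowerSumAlgHom k (bracket k x) = matrixUnit k x := by
  rw [bracket, map_sum]
  simp_rw [map_smul]
  exact sum_mobius_smul (lowerSumAlgHom_of k) x

-- By `hinj`, the matrix position given by the two idempotents of `z` belongs to the matrix unit of
-- `z` alone, so the entry there is the sum of the coefficients of all `y` above `z`.
open Classical in
theorem lowerSumAlgHom_injective
    (hinj : ∀ x y : M, x * inv x = y * inv y → inv x * x = inv y * y → x = y) :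
    Function.Injective (lowerSumAlgHom (M := M) k) := by
  have := Fintype.ofFinite M
  refine (injective_iff_map_eq_zero _).2 fun a ha => ?_
  refine MonoidAlgebra.ext (Finsupp.ext fun x => eq_zero_of_sum_upper_eq_zero (a := fun x => a.coeff x) (fun z => ?_) x)
  right
  have h := congrFun (congrFun (congrFun ha (cell z)) ⟨z * inv z, idem_mul_inv z, cell_mul_inv z⟩)
    ⟨inv z * z, idem_inv_mul z, cell_inv_mul z⟩
  refine Eq.trans ?_ h
  conv_rhs => rw [← sum_coeff_smul_of a]
  rw [map_sum]
  simp_rw [map_smul, lowerSumAlgHom_of]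
  rw [Finset.sum_apply, Matrix.sum_apply]
  refine Finset.sum_congr rfl fun y _ => ?_
  rw [Pi.smul_apply, Matrix.smul_apply, Finset.sum_apply, Matrix.sum_apply]
  simp_rw [matrixUnit_apply]
  have : ∀ w, (w * inv w = z * inv z ∧ inv w * w = inv z * z) ↔ w = z := fun w =>
    ⟨fun h => hinj w z h.1 h.2, fun h => by simp [h]⟩
  simp [this, mem_lower]

/-- Brackets map to the matrix units of elements, and `hsurj` says that every matrix unit arises
from an element. -/
theorem lowerSumAlgHom_surjective
    (hsurj : ∀ e f : M, IsIdempotentElem e → IsIdempotentElem f → cell e = cell f →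
      ∃ x, x * inv x = e ∧ inv x * x = f) :
    Function.Surjective (lowerSumAlgHom (M := M) k) := by
  classical
  have := Fintype.ofFinite (JCell M)
  intro F
  change F ∈ (lowerSumAlgHom (M := M) k).range
  rw [← Finset.univ_sum_single F]
  refine sum_mem fun J _ => ?_
  have : (Pi.single J (F J) : ∀ J : JCell M, Matrix (CellIdem J) (CellIdem J) k) =
      ∑ r, ∑ c, F J r c • Pi.single J (Matrix.single r c (1 : k)) := by
    conv_lhs => rw [Matrix.matrix_eq_sum_single (F J)]
    change LinearMap.single k _ J _ = ∑ r, ∑ c, F J r c • LinearMap.single k _ J _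
    simp_rw [map_sum, ← map_smul, Matrix.smul_single, smul_eq_mul, mul_one]
  rw [this]
  refine sum_mem fun r _ => sum_mem fun c _ => Subalgebra.smul_mem _ ?_ _
  obtain ⟨x, h₁, h₂⟩ := hsurj r.1 c.1 r.2.1 c.2.1 (r.2.2.trans c.2.2.symm)
  refine ⟨bracket k x, ?_⟩
  refine (lowerSumAlgHom_bracket k x).trans ?_
  obtain ⟨r, hr, hr'⟩ := r
  obtain ⟨c, hc, hc'⟩ := c
  subst h₁ h₂
  obtain rfl : cell x = J := (cell_mul_inv x).symm.trans hr'
  rfl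

end Matrices

end InvMon

namespace CrysTL

open Signs

/-! ### The Jones–Wenzl projector on sign sequences. -/

section JonesWenzl

variable {k : Type*} [CommRing k]

/-- Since positions are removed from right to left, deleting one pair leaves the remaining peaks in
place. -/
theorem act_cupCap_single (I : List ℕ) (n : ℕ) (hI : I.Pairwise fun i j => j + 1 < i)
    (hn : ∀ i ∈ I, i + 1 < n) (w : Signs) :
    act (m := n) (n := n) (cupCap k n I) (Pi.single w 1) =
      if ∀ i ∈ I, w.Peak i then Pi.single w 1 else 0 := by
  induction I generalizing n w with
  | nil => simpa [cupCap] using congrArg (· (Pi.single w 1)) (act_id (k := k) n)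
  | cons i I ih =>
    obtain ⟨hi, hI⟩ := List.pairwise_cons.1 hI
    have hin := hn i (by simp)
    obtain ⟨n, rfl⟩ : ∃ m, n = m + 2 := ⟨n - 2, by omega⟩
    rw [cupCap, dif_pos (by omega : i ≤ n), act_comp_apply, act_comp_apply]
    by_cases hp : w.Peak i
    · obtain ⟨v, rfl⟩ : ∃ v, w = ins i v := ⟨_, (ins_del hp).symm⟩
      rw [act_cap_single_ins, ih n hI fun j hj => by have := hi j hj; omega]
      have : (∀ j ∈ i :: I, (ins i v).Peak j) ↔ ∀ j ∈ I, v.Peak j := by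
        rw [List.forall_mem_cons]
        exact ⟨fun h j hj => (peak_ins_of_lt (hi j hj) v).1 (h.2 j hj),
          fun h => ⟨hp, fun j hj => (peak_ins_of_lt (hi j hj) v).2 (h j hj)⟩⟩
      simp only [this]
      split_ifs
      · rw [act_cup_single]
      · rw [map_zero]
    · rw [act_cap_single_of_not_peak _ _ _ hp, map_zero, map_zero, if_neg]
      exact fun h => hp (h i (by simp))

/-- Adjacent positions are never both peaks, so the condition of non-adjacency is automatic and a
full power set remains. -/
theorem filter_aptSubsets (n : ℕ) (w : Signs) :
    (aptSubsets n).filter (fun I => ∀ i ∈ I, w.Peak i) =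
      ((Finset.range n).filter fun i => i + 1 ≠ n ∧ w.Peak i).powerset := by
  ext I
  simp only [aptSubsets, Finset.mem_filter, Finset.mem_powerset, Finset.subset_iff]
  constructor
  · rintro ⟨⟨h₁, h₂⟩, h₃⟩ i hi
    exact ⟨h₁ hi, (h₂ i hi).1, h₃ i hi⟩
  · intro h
    refine ⟨⟨fun i hi => (h hi).1, fun i hi => ⟨(h hi).2.1, fun hi' => ?_⟩⟩,
      fun i hi => (h hi).2.2⟩
    have h₁ := (h hi).2.2.2
    rw [(h hi').2.2.1] at h₁
    exact Bool.noConfusion h₁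

-- Inclusion–exclusion: the alternating sum over all subsets of the set of peaks vanishes unless
-- this set is empty.
open Classical in
theorem act_jonesWenzl_single (n : ℕ) (w : Signs) :
    act (m := n) (n := n) (jonesWenzl k n) (Pi.single w 1) =
      if ∃ i, i + 1 < n ∧ w.Peak i then 0 else Pi.single w 1 := by
  have h : act (m := n) (n := n) (jonesWenzl k n) (Pi.single w 1) =
      ∑ I ∈ aptSubsets n, if ∀ i ∈ I, w.Peak i then (-1 : k) ^ I.card • Pi.single w 1 else 0 := by
    have : act (m := n) (n := n) (jonesWenzl k n) = ∑ I ∈ aptSubsets n, (-1 : k) ^ I.card •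
        act (m := n) (n := n) (cupCap k n (I.sort (· ≥ ·))) := by
      rw [jonesWenzl]
      exact (map_sum (act (k := k) (m := n) (n := n)) _ _).trans
        (Finset.sum_congr rfl fun I _ => map_smul (act (k := k) (m := n) (n := n)) _ _)
    rw [this, LinearMap.sum_apply]
    refine Finset.sum_congr rfl fun I hI => ?_
    obtain ⟨hI₁, hI₂⟩ := Finset.mem_filter.1 hI
    have hs : (I.sort (· ≥ ·)).Pairwise fun i j => j + 1 < i := by
      refine List.Pairwise.imp_of_mem ?_ I.sortedGT_sort.pairwise
      intro i j hi hj hij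
      have := (hI₂ j ((Finset.mem_sort _).1 hj)).2
      have hne : i ≠ j + 1 := fun e => this (e ▸ (Finset.mem_sort _).1 hi)
      have : j < i := hij
      omega
    rw [LinearMap.smul_apply, act_cupCap_single _ _ hs]
    · simp only [Finset.mem_sort]
      split_ifs
      · rfl
      · rw [smul_zero]
    · intro i hi
      have hi' := (Finset.mem_sort _).1 hi
      have h₁ := Finset.mem_range.1 (Finset.mem_powerset.1 hI₁ hi')
      have h₂ := (hI₂ i hi').1
      omega
  rw [h, ← Finset.sum_filter, filter_aptSubsets, ← Finset.sum_smul]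
  have hc : ∀ s : Finset ℕ, ∑ I ∈ s.powerset, (-1 : k) ^ I.card = if s = ∅ then 1 else 0 := by
    intro s
    have := congrArg (Int.cast : ℤ → k) (Finset.sum_powerset_neg_one_pow_card (x := s))
    push_cast at this
    exact this
  rw [hc]
  by_cases he : ∃ i, i + 1 < n ∧ w.Peak i
  · rw [if_pos he, if_neg, zero_smul]
    obtain ⟨i, hi, hp⟩ := he
    exact Finset.ne_empty_of_mem (a := i)
      (Finset.mem_filter.2 ⟨Finset.mem_range.2 (by omega), by omega, hp⟩)
  · rw [if_neg he, if_pos, one_smul]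
    refine Finset.filter_eq_empty_iff.2 fun i hi hi' => he ⟨i, ?_, hi'.2⟩
    have := Finset.mem_range.1 hi
    omega

end JonesWenzl

/-! ### Max-summand morphisms at the test positions. -/

section MaxSummand

variable {k : Type*} [CommRing k] {n : ℕ}

theorem CupCapFactorization.isCupWord_mirror {m : ℕ} {f : obj k m ⟶ obj k n}
    (d : CupCapFactorization f) : IsCupWord k (mirror d.capPart) := d.isCap.2.mirrored

theorem CupCapFactorization.mirror_comp {m : ℕ} {f : obj k m ⟶ obj k n}
    (d : CupCapFactorization f) : mirror (mirror d.capPart) ≫ d.cupPart = f := by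
  rw [d.isCap.2.isWord.mirror_mirror, d.fac]

variable [Nontrivial k]

/-- The factorization of `a ∘ b̄` for cup words `a`, `b`. -/
noncomputable def CupCapFactorization.ofCups {l m : ℕ} {a : obj k l ⟶ obj k n}
    {b : obj k l ⟶ obj k m} (ha : IsCupWord k a) (hb : IsCupWord k b) :
    CupCapFactorization (mirror b ≫ a) where
  th := l
  capPart := mirror b
  cupPart := a
  isCap := by
    refine ⟨fun h => (IsCupWord.id (k := k) l).ne_zero ?_, hb.mirrored⟩
    rw [← hb.comp_mirror, h, Limits.comp_zero]
  isCup := ⟨ha.ne_zero, ha⟩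
  fac := rfl

theorem CupCapFactorization.subsingleton {m : ℕ} {f : obj k m ⟶ obj k n} :
    Subsingleton (CupCapFactorization f) where
  allEq d d' := by
    have h := fac_unique d.isCupWord_mirror d.isCup.2 d'.isCupWord_mirror d'.isCup.2
      (by rw [d.mirror_comp, d'.mirror_comp])
    have e := d.isCap.2.isWord.mirror_mirror
    have e' := d'.isCap.2.isWord.mirror_mirror
    obtain ⟨l, v, u, hv, hu, hf⟩ := d
    obtain ⟨l', v', u', hv', hu', hf'⟩ := d'
    dsimp only at h e e'
    obtain ⟨rfl, h⟩ := Sigma.mk.inj_iff.1 h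
    obtain ⟨rfl, h⟩ := Prod.mk_inj.1 (eq_of_heq h)
    obtain rfl : v = v' := by rw [← e, ← e', h]
    rfl

theorem maxSummand_fac {l m : ℕ} {a : obj k l ⟶ obj k n}
    {b : obj k l ⟶ obj k m} (ha : IsCupWord k a) (hb : IsCupWord k b) :
    maxSummand (mirror b ≫ a) = mirror b ≫ jonesWenzl k l ≫ a := by
  have h : Nonempty (CupCapFactorization (mirror b ≫ a)) :=
    ⟨CupCapFactorization.ofCups ha hb⟩
  rw [maxSummand, dif_pos h,
    CupCapFactorization.subsingleton.elim h.some (CupCapFactorization.ofCups ha hb)]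
  rfl

theorem maxSummand_zero {m : ℕ} : maxSummand (0 : obj k m ⟶ obj k n) = 0 := by
  rw [maxSummand, dif_neg]
  rintro ⟨d⟩
  exact fac_ne_zero d.isCupWord_mirror d.isCup.2 (by rw [d.mirror_comp, map_zero])

/-- The caps bring `p` to the constant sequence, which has no peak and is fixed by the projector. -/
theorem act_maxSummand_self {l m : ℕ} {a : obj k l ⟶ obj k n} {b : obj k l ⟶ obj k m}
    (ha : IsCupWord k a) (hb : IsCupWord k b) {p q : Signs} (hp : Hits b p) (hq : Hits a q) :
    act (maxSummand (mirror b ≫ a)) (Pi.single p 1) = Pi.single q 1 := by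
  rw [maxSummand_fac ha hb, act_comp_apply, hb.act_mirror_single hp, act_comp_apply,
    act_jonesWenzl_single, if_neg, hq]
  rintro ⟨i, -, h⟩
  exact not_peak_top i h

theorem IsCupWord.exists_peak {m n : ℕ} {f : obj k m ⟶ obj k n} (hf : IsCupWord k f)
    (hmn : m ≠ n) {w : Signs} (hw : Hits f w) : ∃ i, i + 1 < n ∧ w.Peak i := by
  cases hf with
  | id => exact absurd rfl hmn
  | comp_cup i h hf =>
    obtain ⟨v, hv⟩ := hf.exists_hits
    obtain rfl := hw.unique (hv.comp_cup i h)
    exact ⟨i, by omega, peak_ins i v⟩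

/-- If `b' ≫ mirror b` does not kill the constant sequence, it is a cup word. A nontrivial cup word
has a peak and is killed by the projector; if it is the identity, then `b' = b`, and `a' ≠ a` have
different sequences. -/
theorem act_maxSummand_of_ne {l l' m : ℕ} {a : obj k l ⟶ obj k n} {b : obj k l ⟶ obj k m}
    {a' : obj k l' ⟶ obj k n} {b' : obj k l' ⟶ obj k m}
    (ha : IsCupWord k a) (hb : IsCupWord k b) (ha' : IsCupWord k a') (hb' : IsCupWord k b')
    {p q : Signs} (hp : Hits b' p) (hq : Hits a' q) (h : mirror b' ≫ a' ≠ mirror b ≫ a) :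
    act (maxSummand (mirror b ≫ a)) (Pi.single p 1) q = 0 := by
  rw [maxSummand_fac ha hb, act_comp_apply, act_comp_apply, ← hp, ← act_comp_apply b']
  have hD := hb'.isWord.comp hb.mirrored.isWord
  obtain h₀ | ⟨w, hw⟩ := hD.act_single top
  · rw [h₀, map_zero, map_zero]; rfl
  · have hD' := hD.isCupWord (hw ▸ single_ne_zero w)
    rw [hw, act_jonesWenzl_single]
    split_ifs with hpk
    · rw [map_zero]; rfl
    · by_cases hl : l' = l
      · subst hl
        have hDid := hD'.eq_id
        obtain rfl := Hits.unique hw (hDid ▸ hits_id _)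
        have hbp : Hits b p := by
          refine hb.hits_of_act_mirror ?_
          rw [← hp, ← act_comp_apply, hw]
        obtain rfl := eq_of_heq (Sigma.mk.inj_iff.1 (hb'.eq_of_hits hb hp hbp)).2
        obtain ⟨r, hr⟩ := ha.exists_hits
        rw [hr, Pi.single_eq_of_ne]
        rintro rfl
        obtain rfl := eq_of_heq (Sigma.mk.inj_iff.1 (ha'.eq_of_hits ha hq hr)).2
        exact h rfl
      · exact absurd (hD'.exists_peak hl hw) hpk

end MaxSummand

/-! ### Finiteness of `T_n`. -/

section Finite

variable {k : Type*} [CommRing k]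

theorem IsCupWord.eq_true_of_le {m n : ℕ} {f : obj k m ⟶ obj k n} (hf : IsCupWord k f) :
    ∃ w, Hits f w ∧ ∀ j, n ≤ j → w j = true := by
  induction hf with
  | id => exact ⟨top, hits_id _, fun _ _ => rfl⟩
  | comp_cup i h _ ih =>
    obtain ⟨w, hw, hw'⟩ := ih
    refine ⟨_, hw.comp_cup i h, fun j hj => ?_⟩
    have := hw' (j - 2) (by omega)
    simp only [ins]
    grind

instance finite_signs (n : ℕ) : Finite {w : Signs // ∀ j, n ≤ j → w j = true} := by
  refine Finite.of_injective (β := Fin n → Bool) (fun w i => w.1 i) fun w w' h => ?_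
  refine Subtype.ext (funext fun j => ?_)
  by_cases hj : j < n
  · exact congrFun h ⟨j, hj⟩
  · rw [w.2 j (by omega), w'.2 j (by omega)]

variable [Nontrivial k] {n : ℕ}

instance T.instFinite : Finite (T k n) := by
  let S := {w : Signs // ∀ j, n ≤ j → w j = true}
  let F (x : T k n) : Set (S × S) :=
    {s | act (m := n) (n := n) (x : End (obj k n)) (Pi.single s.1.1 1) = Pi.single s.2.1 1}
  -- Only sequences equal to `+` from position `n` on are needed to test the order, so antisymmetry
  -- embeds `T_n` into the relations on a finite set.
  have key {x y : T k n} (h : F x ⊆ F y) : InvMon.NatLE x y := by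
    by_cases hx : x = 0
    · exact ⟨0, IsIdempotentElem.zero, by rw [hx, mul_zero]⟩
    · obtain ⟨j, a, b, ha, hb, rfl⟩ := T.exists_ofCups hx
      obtain ⟨p, hp, hp'⟩ := hb.eq_true_of_le
      obtain ⟨q, hq, hq'⟩ := ha.eq_true_of_le
      rw [T.natLE_iff ha hb hp hq]
      exact @h (⟨p, hp'⟩, ⟨q, hq'⟩) (act_fac_single hb hp hq)
  refine Finite.of_injective F fun x y h => ?_
  let := InvMon.natOrder (T k n)
  exact le_antisymm (α := T k n) (key h.subset) (key h.superset)

end Finite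

end CrysTL

namespace InvMon

/-- The group inverse is the inverse in the monoid, so `x` and `e` have the same two idempotents. -/
theorem trivialMaximalSubgroups_of_injective {M : Type*} [Monoid M] [IsInverse M]
    (hinj : ∀ x y : M, x * inv x = y * inv y → inv x * x = inv y * y → x = y) :
    TrivialMaximalSubgroups M := by
  intro e he x y hx hy hxy hyx
  have hex : e * x = x := by
    rw [← hx, ← mul_assoc, ← mul_assoc, he.eq]
  have hey : e * y = y := by
    rw [← hy, ← mul_assoc, ← mul_assoc, he.eq]
  have h : inv x = y := by
    refine inv_unique (mul_inv_mul x) (inv_mul_inv x) ?_ ?_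
    · rw [hxy, hex]
    · rw [hyx, hey]
  refine hinj x e ?_ ?_
  · rw [h, hxy, inv_eq_self he, he.eq]
  · rw [h, hyx, inv_eq_self he, he.eq]

end InvMon

namespace CrysTL

open Signs

/-! ### Green's relation and the number of through-strands. -/

section Green

variable {k : Type*} [CommRing k] {n : ℕ}

theorem T.cell_ofCups {j : ℕ} {a b a' b' : obj k j ⟶ obj k n}
    (ha : IsCupWord k a) (hb : IsCupWord k b) (ha' : IsCupWord k a') (hb' : IsCupWord k b') :
    InvMon.cell (T.ofCups ha hb) = InvMon.cell (T.ofCups ha' hb') := by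
  have key {a b a' b' : obj k j ⟶ obj k n} (ha : IsCupWord k a) (hb : IsCupWord k b)
      (ha' : IsCupWord k a') (hb' : IsCupWord k b') (z : T k n)
      (hz : ∃ x y, z = x * T.ofCups ha hb * y) : ∃ x y, z = x * T.ofCups ha' hb' * y := by
    obtain ⟨x, y, rfl⟩ := hz
    refine ⟨x * T.ofCups ha ha', T.ofCups hb' hb * y, ?_⟩
    calc x * T.ofCups ha hb * y
        = x * (T.ofCups ha ha' * T.ofCups ha' hb' * T.ofCups hb' hb) * y := by
          rw [T.ofCups_mul, T.ofCups_mul]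
      _ = x * T.ofCups ha ha' * T.ofCups ha' hb' * (T.ofCups hb' hb * y) := by
          simp only [mul_assoc]
  exact Quotient.sound (Set.ext fun z => ⟨key ha hb ha' hb' z, key ha' hb' ha hb z⟩)

variable [Nontrivial k]

/-- The idempotents of `a ∘ b̄` are those of `a` and of `b`, and each determines its cup word. -/
theorem T.eq_of_inv {x y : T k n} (h₁ : x * InvMon.inv x = y * InvMon.inv y)
    (h₂ : InvMon.inv x * x = InvMon.inv y * y) : x = y := by
  have key {x y : T k n} (hx : x = 0) (h₁ : x * InvMon.inv x = y * InvMon.inv y) : x = y := by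
    rw [← InvMon.mul_inv_mul y, ← h₁, hx, zero_mul, zero_mul]
  by_cases hx : x = 0
  · exact key hx h₁
  by_cases hy : y = 0
  · exact (key hy h₁.symm).symm
  obtain ⟨j, a, b, ha, hb, rfl⟩ := T.exists_ofCups hx
  obtain ⟨j', a', b', ha', hb', rfl⟩ := T.exists_ofCups hy
  simp only [T.inv_ofCups, T.ofCups_mul] at h₁ h₂
  obtain ⟨rfl, e⟩ := Sigma.mk.inj_iff.1 (T.ofCups_injective h₁)
  obtain ⟨rfl, -⟩ := Prod.mk_inj.1 (eq_of_heq e)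
  obtain ⟨-, e⟩ := Sigma.mk.inj_iff.1 (T.ofCups_injective h₂)
  obtain ⟨rfl, -⟩ := Prod.mk_inj.1 (eq_of_heq e)
  rfl

theorem exists_mul_mul_of_cell_eq {M : Type*} [Monoid M] {x y : M}
    (h : InvMon.cell x = InvMon.cell y) : ∃ a b, x = a * y * b := by
  have : {z : M | ∃ a b, z = a * x * b} = {z : M | ∃ a b, z = a * y * b} := Quotient.exact h
  have hx : x ∈ {z : M | ∃ a b, z = a * x * b} := ⟨1, 1, by simp⟩
  rwa [this] at hx

theorem eq_zero_of_cell_eq {M : Type*} [MonoidWithZero M] {x : M}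
    (h : InvMon.cell x = InvMon.cell 0) : x = 0 := by
  obtain ⟨a, b, e⟩ := exists_mul_mul_of_cell_eq h
  rw [e, mul_zero, zero_mul]

theorem T.cell_ofCups_le {j j' : ℕ} {a b : obj k j ⟶ obj k n} {a' b' : obj k j' ⟶ obj k n}
    (ha : IsCupWord k a) (hb : IsCupWord k b) (ha' : IsCupWord k a') (hb' : IsCupWord k b')
    (h : InvMon.cell (T.ofCups ha hb) = InvMon.cell (T.ofCups ha' hb')) : j ≤ j' := by
  obtain ⟨x, y, e⟩ := exists_mul_mul_of_cell_eq h
  have hy : y ≠ 0 := by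
    rintro rfl
    exact T.ofCups_ne_zero ha hb (by rw [e, mul_zero])
  have e' := congrArg Subtype.val e
  rw [T.coe_mul, T.coe_mul] at e'
  exact fac_le (a' := a') hb ha hb' (T.isWord hy) e'

theorem T.exists_of_cell_eq {e f : T k n} (he : IsIdempotentElem e) (hf : IsIdempotentElem f)
    (h : InvMon.cell e = InvMon.cell f) :
    ∃ x : T k n, x * InvMon.inv x = e ∧ InvMon.inv x * x = f := by
  by_cases he₀ : e = 0
  · have hf₀ : f = 0 := eq_zero_of_cell_eq (by rw [← h, he₀])
    exact ⟨0, by rw [zero_mul, he₀], by rw [mul_zero, hf₀]⟩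
  · have hf₀ : f ≠ 0 := by
      rintro rfl
      exact he₀ (eq_zero_of_cell_eq h)
    obtain ⟨j, a, ha, rfl⟩ := T.exists_of_isIdempotentElem he₀ he
    obtain ⟨j', b, hb, rfl⟩ := T.exists_of_isIdempotentElem hf₀ hf
    obtain rfl := le_antisymm (T.cell_ofCups_le ha ha hb hb h)
      (T.cell_ofCups_le hb hb ha ha h.symm)
    exact ⟨T.ofCups ha hb, by simp only [T.inv_ofCups, T.ofCups_mul],
      by simp only [T.inv_ofCups, T.ofCups_mul]⟩

theorem T.cell_eq_iff {x y : T k n}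
    (d : CupCapFactorization (k := k) (m := n) (n := n) (x : End (obj k n)))
    (d' : CupCapFactorization (k := k) (m := n) (n := n) (y : End (obj k n))) :
    InvMon.cell x = InvMon.cell y ↔ d.th = d'.th := by
  have key {x : T k n} (d : CupCapFactorization (k := k) (m := n) (n := n) (x : End (obj k n))) :
      x = T.ofCups d.isCup.2 d.isCupWord_mirror := Subtype.ext d.mirror_comp.symm
  have hx := key d
  have hy := key d'
  refine ⟨fun h => ?_, fun h => ?_⟩
  · rw [hx, hy] at h
    exact le_antisymm (T.cell_ofCups_le _ _ _ _ h) (T.cell_ofCups_le _ _ _ _ h.symm)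
  -- The numbers of through-strands become variables, so that their equality can be substituted.
  · have aux {j j' : ℕ} {a b : obj k j ⟶ obj k n} {a' b' : obj k j' ⟶ obj k n}
        (ha : IsCupWord k a) (hb : IsCupWord k b) (ha' : IsCupWord k a') (hb' : IsCupWord k b')
        (h : j = j') (hx : x = T.ofCups ha hb) (hy : y = T.ofCups ha' hb') :
        InvMon.cell x = InvMon.cell y := by
      subst h
      rw [hx, hy]
      exact T.cell_ofCups ha hb ha' hb'
    exact aux _ _ _ _ h hx hy

end Green

/-! ### Separating endomorphisms of `[n]` by matrix entries. -/

section Algebra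

variable {k : Type*} [CommRing k] {n : ℕ}

theorem isWord_path {X Y : Strands} (p : Quiver.Path X Y) :
    IsWord k (m := X.num) (n := Y.num) ((CategoryTheory.Quotient.functor (homRel k)).map
      ((Free.embedding k (Paths Strands)).map
        (X := (Paths.of Strands).obj X) (Y := (Paths.of Strands).obj Y) p)) := by
  induction p with
  | nil => exact IsWord.id (k := k) X.num
  | cons p f ih =>
    change Basic _ _ at f
    have e := (congrArg (CategoryTheory.Quotient.functor (homRel k)).map
      ((Free.embedding k (Paths Strands)).map_comp p ((Paths.of Strands).map f))).trans
      ((CategoryTheory.Quotient.functor (homRel k)).map_comp _ _)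
    cases f with
    | cup n i h => exact (congrArg (IsWord k) e).mpr (ih.comp_cup i h)
    | cap n i h => exact (congrArg (IsWord k) e).mpr (ih.comp_cap i h)

theorem span_words (m n : ℕ) : Submodule.span k {f : obj k m ⟶ obj k n | IsWord k f} = ⊤ := by
  refine top_unique fun f _ => ?_
  obtain ⟨f, rfl⟩ := (CategoryTheory.Quotient.functor (homRel k)).map_surjective f
  induction f using free_induction with
  | zero => exact (congrArg (· ∈ _) (CategoryTheory.Functor.map_zero _ _ _)).mpr (zero_mem _)
  | add f g hf hg => exact (congrArg (· ∈ _) (CategoryTheory.Functor.map_add _)).mpr (add_mem (hf trivial) (hg trivial))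
  | smul a f =>
    exact Submodule.smul_mem _ a (Submodule.subset_span (isWord_path f))

variable (k n) in
/-- The algebra homomorphism from the monoid algebra of `T_n` to `End([n])`. -/
noncomputable def evalHom : MonoidAlgebra k (T k n) →ₐ[k] End (obj k n) :=
  MonoidAlgebra.lift k _ _ (T k n).subtype

theorem evalHom_of (x : T k n) : evalHom k n (MonoidAlgebra.of k _ x) = x :=
  MonoidAlgebra.lift_of _ _

theorem evalHom_surjective : Function.Surjective (evalHom k n) := by
  intro f
  change f ∈ LinearMap.range (evalHom k n).toLinearMap
  have h := span_words (k := k) n n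
  have : Submodule.span k {f : obj k n ⟶ obj k n | IsWord k f} ≤
      LinearMap.range (evalHom k n).toLinearMap := by
    refine Submodule.span_le.2 fun g hg => ?_
    exact ⟨MonoidAlgebra.of k _ (T.ofWord hg), evalHom_of _⟩
  exact this (h ▸ Submodule.mem_top)

-- The coefficient of the zero element is invisible in `End([n])`; it is reset to `0` because the
-- zero element has no test position.
open Classical in
theorem sum_coeff_eq [Fintype (T k n)] (a : MonoidAlgebra k (T k n)) :
    ∑ y : T k n, (if y = 0 then 0 else a.coeff y) • (y : End (obj k n)) = evalHom k n a := by
  conv_rhs => rw [← InvMon.sum_coeff_smul_of a]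
  rw [map_sum]
  refine Finset.sum_congr rfl fun y _ => ?_
  rw [map_smul, evalHom_of]
  split_ifs with hy
  · rw [hy, T.coe_zero, zero_smul, smul_zero]
  · rfl

variable [Nontrivial k]

theorem act_coe_single_apply {j : ℕ} {a b : obj k j ⟶ obj k n} (ha : IsCupWord k a)
    (hb : IsCupWord k b) {p q : Signs} (hp : Hits b p) (hq : Hits a q) (y : T k n)
    [Decidable (InvMon.NatLE (T.ofCups ha hb) y)] :
    act (m := n) (n := n) (y : End (obj k n)) (Pi.single p 1) q =
      if InvMon.NatLE (T.ofCups ha hb) y then 1 else 0 := by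
  split_ifs with h
  · rw [(T.natLE_iff ha hb hp hq y).1 h, Pi.single_eq_same]
  · rw [T.natLE_iff ha hb hp hq y] at h
    obtain h' | ⟨w, h'⟩ := T.act_single y p
    · rw [h']; rfl
    · rw [h', Pi.single_eq_of_ne]
      rintro rfl
      exact h h'

/-- A combination of elements of `T_n` without zero part vanishes if its matrix entries do. -/
theorem coeff_eq_zero [Fintype (T k n)] {a : T k n → k} (ha₀ : a 0 = 0)
    (h : ∀ (j : ℕ) (u v : obj k j ⟶ obj k n), IsCupWord k u → IsCupWord k v → ∀ p q : Signs,
      Hits v p → Hits u q →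
      act (m := n) (n := n) (∑ y, a y • (y : End (obj k n))) (Pi.single p 1) q = 0)
    (x : T k n) : a x = 0 := by
  classical
  refine InvMon.eq_zero_of_sum_upper_eq_zero (fun z => ?_) x
  by_cases hz : z = 0
  · exact Or.inl (hz ▸ ha₀)
  right
  obtain ⟨j, u, v, hu, hv, rfl⟩ := T.exists_ofCups hz
  obtain ⟨p, hp⟩ := hv.exists_hits
  obtain ⟨q, hq⟩ := hu.exists_hits
  refine Eq.trans ?_ (h j u v hu hv p q hp hq)
  have e : act (m := n) (n := n) (∑ y, a y • (y : End (obj k n))) =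
      ∑ y : T k n, a y • act (m := n) (n := n) (y : End (obj k n)) :=
    (map_sum (act (k := k) (m := n) (n := n)) _ _).trans
      (Finset.sum_congr rfl fun y _ => map_smul (act (k := k) (m := n) (n := n)) _ _)
  rw [e, LinearMap.sum_apply, Finset.sum_apply]
  refine Finset.sum_congr rfl fun y _ => ?_
  rw [LinearMap.smul_apply, Pi.smul_apply, act_coe_single_apply hu hv hp hq, smul_eq_mul,
    mul_ite, mul_one, mul_zero]

open Classical in
/-- A morphism vanishes if its matrix entries do. -/
theorem end_eq_zero {f : End (obj k n)}
    (h : ∀ (j : ℕ) (u v : obj k j ⟶ obj k n), IsCupWord k u → IsCupWord k v → ∀ p q : Signs,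
      Hits v p → Hits u q → act (m := n) (n := n) f (Pi.single p 1) q = 0) : f = 0 := by
  have := Fintype.ofFinite (T k n)
  obtain ⟨a, rfl⟩ := evalHom_surjective f
  simp_rw [← sum_coeff_eq a] at h ⊢
  refine Finset.sum_eq_zero fun y _ => ?_
  rw [coeff_eq_zero (a := fun y => if y = 0 then 0 else a.coeff y) (if_pos rfl) h y, zero_smul]

/-- At the test positions the max-summand morphisms form an identity matrix. -/
theorem act_maxSummand_apply {j : ℕ} {a b : obj k j ⟶ obj k n} (ha : IsCupWord k a)
    (hb : IsCupWord k b) {p q : Signs} (hp : Hits b p) (hq : Hits a q) (y : T k n)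
    [Decidable (y = T.ofCups ha hb)] :
    act (m := n) (n := n) (maxSummand (k := k) (m := n) (n := n) (y : End (obj k n)))
      (Pi.single p 1) q = if y = T.ofCups ha hb then 1 else 0 := by
  split_ifs with h
  · subst h
    refine (congrFun (act_maxSummand_self ha hb hp hq) q).trans ?_
    rw [Pi.single_eq_same]
  · by_cases hy : y = 0
    · subst hy
      rw [T.coe_zero]
      have e : act (m := n) (n := n) (maxSummand (k := k) (m := n) (n := n) 0) = 0 := by
        rw [maxSummand_zero, map_zero]
      exact congrFun (congrArg (fun g : Module.End k (Signs → k) => g (Pi.single p 1)) e) q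
    · obtain ⟨j', a', b', ha', hb', rfl⟩ := T.exists_ofCups hy
      exact act_maxSummand_of_ne ha' hb' ha hb hp hq fun e => h (Subtype.ext e.symm)

/-- At the test position of a diagram `z`, both sides have entry `1` if `z ≼ x` and `0` otherwise,
and test positions separate endomorphisms. -/
theorem coe_eq_sum_maxSummand (x : T k n) :
    (x : End (obj k n)) = ∑ y ∈ InvMon.lower x,
      maxSummand (k := k) (m := n) (n := n) (y : End (obj k n)) := by
  classical
  rw [← sub_eq_zero]
  refine end_eq_zero fun j u v hu hv p q hp hq => ?_
  have e : act (m := n) (n := n) ((x : End (obj k n)) - (∑ y ∈ InvMon.lower x,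
      maxSummand (k := k) (m := n) (n := n) (y : End (obj k n)) : End (obj k n))) =
      act (m := n) (n := n) (x : End (obj k n)) - ∑ y ∈ InvMon.lower x,
        act (m := n) (n := n) (maxSummand (k := k) (m := n) (n := n) (y : End (obj k n))) :=
    (map_sub (act (k := k) (m := n) (n := n)) _ _).trans (congrArg _ (map_sum _ _ _))
  rw [e, LinearMap.sub_apply, Pi.sub_apply, act_coe_single_apply hu hv hp hq, LinearMap.sum_apply,
    Finset.sum_apply]
  have h₁ : ∀ y : T k n, act (m := n) (n := n)
      (maxSummand (k := k) (m := n) (n := n) (y : End (obj k n))) (Pi.single p 1) q =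
      if y = T.ofCups hu hv then 1 else 0 :=
    fun y => act_maxSummand_apply hu hv hp hq y
  simp_rw [h₁]
  rw [Finset.sum_ite_eq', sub_eq_zero]
  simp only [InvMon.mem_lower]

end Algebra

end CrysTL

namespace CrysTL

open Signs

/-! ### The contracted algebra and the max-summand basis. -/

section Basis

variable {k : Type*} [CommRing k] {n : ℕ}

/-- The homomorphism from the contracted algebra of `T_n` to `End([n])`. -/
noncomputable def contractedHom : InvMon.Contracted k (T k n) →ₐ[k] End (obj k n) :=
  RingQuot.liftAlgHom k ⟨evalHom k n, by
    rintro _ _ ⟨rfl, rfl⟩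
    rw [evalHom_of, map_zero, T.coe_zero]⟩

theorem contractedHom_toContracted (a : MonoidAlgebra k (T k n)) :
    contractedHom (InvMon.toContracted k _ a) = evalHom k n a :=
  RingQuot.liftAlgHom_mkAlgHom_apply k _ _ _

theorem contractedHom_surjective : Function.Surjective (contractedHom (k := k) (n := n)) := by
  intro f
  obtain ⟨a, rfl⟩ := evalHom_surjective f
  exact ⟨_, contractedHom_toContracted a⟩

variable [Nontrivial k]

-- The nonzero diagrams are linearly independent in `End([n])`, and the zero element already
-- vanishes in the contracted algebra.
open Classical in
theorem contractedHom_injective : Function.Injective (contractedHom (k := k) (n := n)) := by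
  have := Fintype.ofFinite (T k n)
  refine (injective_iff_map_eq_zero _).2 fun z hz => ?_
  obtain ⟨a, rfl⟩ := RingQuot.mkAlgHom_surjective k _ z
  have h := (contractedHom_toContracted a).symm.trans hz
  rw [← sum_coeff_eq] at h
  have h₀ := coeff_eq_zero (a := fun y => if y = 0 then 0 else a.coeff y) (if_pos rfl)
    fun j u v _ _ p q _ _ => by
      have h' : act (m := n) (n := n) (∑ y : T k n, (if y = 0 then 0 else a.coeff y) •
          (y : End (obj k n))) = 0 := (congrArg _ h).trans (map_zero (act (k := k)))
      rw [h']; rfl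
  change InvMon.toContracted k _ a = 0
  rw [← InvMon.sum_coeff_smul_of a, map_sum]
  refine Finset.sum_eq_zero fun y _ => ?_
  rw [map_smul]
  by_cases hy : y = 0
  · have : InvMon.toContracted k (T k n) (MonoidAlgebra.of k _ 0) = 0 :=
      (RingQuot.mkAlgHom_rel k ⟨rfl, rfl⟩).trans (map_zero (InvMon.toContracted k _))
    rw [hy, this, smul_zero]
  · have := h₀ y
    rw [if_neg hy] at this
    rw [this, zero_smul]

theorem evalHom_bracket (x : T k n) : evalHom k n (InvMon.bracket k x) =
    maxSummand (k := k) (m := n) (n := n) (x : End (obj k n)) := by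
  rw [InvMon.bracket, map_sum]
  simp_rw [map_smul, evalHom_of]
  exact InvMon.sum_mobius_smul (g := fun y : T k n => (y : End (obj k n)))
    (f := fun y : T k n => (maxSummand (k := k) (m := n) (n := n) (y : End (obj k n)) :
      End (obj k n))) coe_eq_sum_maxSummand x

/-- The max-summand morphism of a nonzero element of `T_n`. -/
noncomputable def T.maxSummand (x : {x : T k n // x ≠ 0}) : End (obj k n) :=
  CrysTL.maxSummand (k := k) (m := n) (n := n) ((x : T k n) : End (obj k n))

theorem T.linearIndependent_maxSummand :
    LinearIndependent k (T.maxSummand (k := k) (n := n)) := by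
  classical
  have := Fintype.ofFinite {x : T k n // x ≠ 0}
  refine Fintype.linearIndependent_iff.2 fun g hg x => ?_
  obtain ⟨x, hx⟩ := x
  obtain ⟨j, a, b, ha, hb, rfl⟩ := T.exists_ofCups hx
  obtain ⟨p, hp⟩ := hb.exists_hits
  obtain ⟨q, hq⟩ := ha.exists_hits
  have e : ∑ y, g y • act (m := n) (n := n) (T.maxSummand y) = 0 := by
    refine Eq.trans ?_ ((congrArg (act (k := k) (m := n) (n := n)) hg).trans (map_zero _))
    exact ((map_sum (act (k := k) (m := n) (n := n)) _ _).trans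
      (Finset.sum_congr rfl fun y _ => map_smul (act (k := k) (m := n) (n := n)) _ _)).symm
  have e' := congrFun (congrArg (fun f : Module.End k (Signs → k) => f (Pi.single p 1)) e) q
  rw [LinearMap.sum_apply, Finset.sum_apply] at e'
  refine Eq.trans ?_ e'
  -- Evaluating at the test position of `x` isolates its coefficient.
  rw [Finset.sum_eq_single ⟨T.ofCups ha hb, hx⟩]
  · rw [LinearMap.smul_apply, Pi.smul_apply, T.maxSummand, act_maxSummand_apply ha hb hp hq,
      if_pos rfl, smul_eq_mul, mul_one]
  · intro y _ hy
    rw [LinearMap.smul_apply, Pi.smul_apply, T.maxSummand, act_maxSummand_apply ha hb hp hq,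
      if_neg fun h => hy (Subtype.ext h), smul_zero]
  · simp

theorem T.span_maxSummand : ⊤ ≤ Submodule.span k (Set.range (T.maxSummand (k := k) (n := n))) := by
  have := Fintype.ofFinite (T k n)
  intro f _
  obtain ⟨a, rfl⟩ := evalHom_surjective f
  rw [← InvMon.sum_coeff_smul_of a, map_sum]
  refine sum_mem fun x _ => ?_
  rw [map_smul, evalHom_of, coe_eq_sum_maxSummand]
  refine Submodule.smul_mem _ _ (sum_mem fun y _ => ?_)
  by_cases hy : y = 0
  · rw [hy, T.coe_zero]
    exact (congrArg (· ∈ _) maxSummand_zero).mpr (zero_mem _)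
  · exact Submodule.subset_span ⟨⟨y, hy⟩, rfl⟩

end Basis

end CrysTL

theorem mainTheorem10 (k : Type*) [Field k] (n : ℕ) :
    -- `T_n` is a finite inverse monoid with trivial maximal subgroups
    ∃ (_ : Finite (CrysTL.T k n)) (_ : InvMon.IsInverse (CrysTL.T k n)),
      InvMon.TrivialMaximalSubgroups (CrysTL.T k n) ∧
      -- `Ψ : k T_n ≅ ∏_J Mat_{E(J)}(k)`, and `[x]` is the preimage of the matrix unit of `x`
      (∃ Ψ : MonoidAlgebra k (CrysTL.T k n) ≃ₐ[k]
          (∀ J : InvMon.JCell (CrysTL.T k n),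
            Matrix (InvMon.CellIdem J) (InvMon.CellIdem J) k),
        (∀ x : CrysTL.T k n, Ψ (MonoidAlgebra.of k (CrysTL.T k n) x) =
          ∑ y ∈ InvMon.lower x, InvMon.matrixUnit k y) ∧
        ∀ x : CrysTL.T k n, InvMon.bracket k x = Ψ.symm (InvMon.matrixUnit k x)) ∧
      -- every Temperley–Lieb diagram is uniquely `u ∘ v`, with `u` a cup and `v` a cap diagram
      (∀ x : CrysTL.T k n, x ≠ 0 → Nonempty (Unique (CrysTL.CupCapFactorization
        (k := k) (m := n) (n := n) (x : End (CrysTL.obj k n))))) ∧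
      -- the blocks of `Ψ` are labelled by the numbers of through-strands, and rows and columns of a
      -- block by cup diagrams: for cup diagrams `a`, `b` with mirror images `a'`, `b'`, the matrix
      -- unit of `x = a ∘ b'` is in the row of `a ∘ a'` and the column of `b ∘ b'`
      (∀ x y : CrysTL.T k n, x ≠ 0 → y ≠ 0 →
        ∀ (d : CrysTL.CupCapFactorization (k := k) (m := n) (n := n) (x : End (CrysTL.obj k n)))
          (d' : CrysTL.CupCapFactorization (k := k) (m := n) (n := n) (y : End (CrysTL.obj k n))),
          InvMon.cell x = InvMon.cell y ↔ d.th = d'.th) ∧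
      (∀ (j : ℕ) (a b : CrysTL.obj k j ⟶ CrysTL.obj k n) (a' b' : CrysTL.obj k n ⟶ CrysTL.obj k j),
        CrysTL.IsCupDiagram a → CrysTL.IsCupDiagram b →
        CrysTL.IsMirror k a a' → CrysTL.IsMirror k b b' →
        ∃ x : CrysTL.T k n, x ≠ 0 ∧ (x : End (CrysTL.obj k n)) = b' ≫ a ∧
          ((x * InvMon.inv x : CrysTL.T k n) : End (CrysTL.obj k n)) = a' ≫ a ∧
          ((InvMon.inv x * x : CrysTL.T k n) : End (CrysTL.obj k n)) = b' ≫ b) ∧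
      -- `End([n])` is the contracted algebra of `T_n`
      ∃ Φ : InvMon.Contracted k (CrysTL.T k n) ≃ₐ[k] End (CrysTL.obj k n),
        (∀ x : CrysTL.T k n,
          Φ (InvMon.toContracted k _ (MonoidAlgebra.of k (CrysTL.T k n) x)) = x) ∧
        -- the max-summand basis is the basis of the brackets `[x]`
        (∀ x : CrysTL.T k n, x ≠ 0 →
          CrysTL.maxSummand (k := k) (m := n) (n := n) (x : End (CrysTL.obj k n)) =
            Φ (InvMon.toContracted k _ (InvMon.bracket k x))) ∧
        ∃ b : Module.Basis {x : CrysTL.T k n // x ≠ 0} k (End (CrysTL.obj k n)),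
          ∀ x : {x : CrysTL.T k n // x ≠ 0},
            b x = CrysTL.maxSummand (k := k) (m := n) (n := n)
              ((x : CrysTL.T k n) : End (CrysTL.obj k n)) := by
  -- This gives both the triviality of the maximal subgroups and the injectivity of `Ψ`.
  have hinj : ∀ x y : CrysTL.T k n, x * InvMon.inv x = y * InvMon.inv y →
      InvMon.inv x * x = InvMon.inv y * y → x = y := fun _ _ => CrysTL.T.eq_of_inv
  refine ⟨CrysTL.T.instFinite, CrysTL.T.instIsInverse,
    InvMon.trivialMaximalSubgroups_of_injective hinj, ?_, ?_, ?_, ?_, ?_⟩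
  · let Ψ := AlgEquiv.ofBijective (InvMon.lowerSumAlgHom (M := CrysTL.T k n) k)
      ⟨InvMon.lowerSumAlgHom_injective k hinj, InvMon.lowerSumAlgHom_surjective k
        fun _ _ => CrysTL.T.exists_of_cell_eq⟩
    exact ⟨Ψ, InvMon.lowerSumAlgHom_of k, fun x =>
      (Ψ.symm_apply_eq.2 (InvMon.lowerSumAlgHom_bracket k x).symm).symm⟩
  · intro x hx
    obtain ⟨j, a, b, ha, hb, rfl⟩ := CrysTL.T.exists_ofCups hx
    have := CrysTL.CupCapFactorization.subsingleton (f := CrysTL.mirror b ≫ a)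
    exact ⟨⟨⟨CrysTL.CupCapFactorization.ofCups ha hb⟩, fun d => this.elim _ _⟩⟩
  · intro x y _ _ d d'
    exact CrysTL.T.cell_eq_iff d d'
  · intro j a b a' b' ha hb haa hbb
    obtain rfl := haa.eq_mirror
    obtain rfl := hbb.eq_mirror
    refine ⟨CrysTL.T.ofCups ha.2 hb.2, CrysTL.T.ofCups_ne_zero _ _, rfl, ?_, ?_⟩
    · rw [CrysTL.T.inv_ofCups, CrysTL.T.ofCups_mul]; rfl
    · rw [CrysTL.T.inv_ofCups, CrysTL.T.ofCups_mul]; rfl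
  · refine ⟨AlgEquiv.ofBijective CrysTL.contractedHom
      ⟨CrysTL.contractedHom_injective, CrysTL.contractedHom_surjective⟩, fun x => ?_,
      fun x _ => ?_, Module.Basis.mk CrysTL.T.linearIndependent_maxSummand
        CrysTL.T.span_maxSummand, fun x => ?_⟩
    · exact (CrysTL.contractedHom_toContracted _).trans (CrysTL.evalHom_of x)
    · exact ((CrysTL.contractedHom_toContracted _).trans (CrysTL.evalHom_bracket x)).symm
    · exact Module.Basis.mk_apply _ _ x
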